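/- For $n\ge 3$ let $S_n$ be the set of tours (Hamiltonian cycles) of the complete graph on $n$ labelled nodes. Its edges carry independent random weights $w(e)$, uniform on $[0,1]$, and a tour $x$ has length $J(x)=\sum_{e\in x}w(e)$. Two tours are 2-opt neighbors if one arises from the other by replacing exactly two edges. One iteration of simulated annealing at inverse temperature $\beta\ge 0$ (temperature $1/\beta$), in state $x$, picks a 2-opt neighbor $y$ of $x$ uniformly at random and moves to $y$ with probability $\min\{1,e^{-\beta(J(y)-J(x))}\}$; otherwise it stays at $x$. Let $t=t(n)\ge 2$ be integers with $t(n)=2^{o(n)}$, let $a=a(n)\ge n$ be reals, and let $L_n(k)$ be natural numbers for which there is a constant $c>0$ such that, for all sufficiently large $n$, $L_n(k)\ge c\,n^9k^2\log n$ for all $1\le k\le t(n)$. Run simulated annealing, from a starting tour $x_0\in S_n$ that does not depend on the weights, for $t(n)$ epochs $k=1,\dots,t(n)$, where epoch $k$ consists of $L_n(k)$ iterations at the constant temperature $T(k)=a(n)/\ln k$ (that is, $\beta=\ln k/a(n)$; in epoch $1$ this is $\beta=0$). Let $J(t)$ be the length of the tour at the end of epoch $t=t(n)$. Then for all sufficiently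 large $n$, and for every starting tour $x_0$, \[ \mathbb{E}(J(t))\;\ge\; n\left(\frac{a}{\ln t}-\frac{1}{t^{1/a}-1}\right), \] where the expectation is over both the random weights and the random choices of the algorithm. -/

import Mathlib

open Filter MeasureTheory Asymptotics
open scoped Matrix

namespace SimAnn

/-- The edges of the complete graph on `n` labelled nodes. -/
abbrev Edge (n : ℕ) : Type := (⊤ : SimpleGraph (Fin n)).edgeSet

/-- A set of edges is a tour if it is the edge set of a Hamiltonian cycle of the complete graph. -/
def IsTour {n : ℕ} (x : Finset (Edge n)) : Prop :=
  ∃ (v : Fin n) (p : (⊤ : SimpleGraph (Fin n)).Walk v v),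
    p.IsHamiltonianCycle ∧ ∀ e : Edge n, e ∈ x ↔ (e : Sym2 (Fin n)) ∈ p.edges

/-- The solution space: (undirected, unrooted) tours through `n` nodes. -/
abbrev Tour (n : ℕ) : Type := {x : Finset (Edge n) // IsTour x}

noncomputable instance instFintypeTour (n : ℕ) : Fintype (Tour n) := Fintype.ofFinite _

/-- The length of the tour `x` for the edge weights `w`. -/
def tourLength {n : ℕ} (w : Edge n → ℝ) (x : Tour n) : ℝ := ∑ e ∈ x.1, w e

/-- The 2-opt neighborhood: the tours that arise from `x` by replacing exactly two of its edges
(all tours have the same number of edges, so two edges leave and two edges enter). -/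
noncomputable def twoOpt {n : ℕ} (x : Tour n) : Finset (Tour n) :=
  Finset.univ.filter fun y => (x.1 \ y.1).card = 2

/-- The probability that one iteration of simulated annealing at inverse temperature `β` proposes
the neighbor `y` of `x` (uniformly among all neighbors) and accepts it. -/
noncomputable def moveProb {n : ℕ} (β : ℝ) (w : Edge n → ℝ) (x y : Tour n) : ℝ :=
  1 / ((twoOpt x).card : ℝ) * min 1 (Real.exp (-β * (tourLength w y - tourLength w x)))

/-- The transition matrix of one iteration of simulated annealing with the 2-opt neighborhood at
inverse temperature `β`; `β = 0` is infinite temperature, where every proposal is accepted. -/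
noncomputable def transition {n : ℕ} (β : ℝ) (w : Edge n → ℝ) : Matrix (Tour n) (Tour n) ℝ :=
  Matrix.of fun x y =>
    if y ∈ twoOpt x then moveProb β w x y
    else if y = x then 1 - ∑ z ∈ twoOpt x, moveProb β w x z
    else 0

/-- The inverse temperature `log k / a` of epoch `k` for the logarithmic schedule
`T(k) = a / log k`. -/
noncomputable def invTemp (a : ℝ) (k : ℕ) : ℝ := Real.log k / a

/-- The law (as a row vector) of the current tour after the epochs `1, …, k` for fixed edge
weights `w`, when the start is `x₀` and epoch `j` consists of `L j` iterations at
inverse temperature `invTemp a j`. -/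
noncomputable def law {n : ℕ} (a : ℝ) (L : ℕ → ℕ) (x₀ : Tour n) (w : Edge n → ℝ) :
    ℕ → Tour n → ℝ
  | 0 => Pi.single x₀ 1
  | k + 1 => law a L x₀ w k ᵥ* transition (invTemp a (k + 1)) w ^ L (k + 1)

/-- The distribution of the edge weights: independent and uniform on `[0, 1]`. -/
noncomputable def weightMeasure (n : ℕ) : Measure (Edge n → ℝ) :=
  Measure.pi fun _ => volume.restrict (Set.Icc (0 : ℝ) 1)

/-- The expectation, over the random edge weights and over the randomness of the algorithm, of the
length of the tour held by simulated annealing at the end of epoch `t`. -/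
noncomputable def expectedLength {n : ℕ} (a : ℝ) (L : ℕ → ℕ) (x₀ : Tour n) (t : ℕ) : ℝ :=
  ∫ w, ∑ x, law a L x₀ w t x * tourLength w x ∂(weightMeasure n)

end SimAnn

/-! Let `p e w` be the probability that the final tour uses the edge `e`, for weights `w`. A tour
has `n` edges, so for any number `m` the expected length minus `n * m` equals the sum over `e` of
the integral of `(w e - m) * p e w`. With `β = log t / a`, the bracket in the theorem is `truncMean
β`, the mean of the density proportional to `exp (-β u)` on `[0, 1]`. Take it as `m`. It then
suffices that, with the other weights frozen, `exp (β u) * p` is nondecreasing in the weight `u` of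
`e`: comparing `p` with the multiple of `exp (-β u)` that agrees with it at `u = m` makes each
integral nonnegative (`integral_sub_truncMean_mul_nonneg`).

Under the Gibbs distribution this monotonicity is immediate, since raising `u` also shrinks the
partition function. The law of the annealed tour is only close to Gibbs, and closeness in total
variation is not enough, because the inequality is needed for arbitrarily small increments `δ`.
Instead, the deviation from Gibbs is shown to be Lipschitz in the weights, with a tiny constant
(`abs_deviation_sub_deviation_le`, `abs_law_deviation_le`). For Gibbs the inequality has a slack of
at least `κ ^ 2 * β * δ / 2`, where `κ` bounds all Gibbs probabilities from below. This slack is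
also linear in `δ` and absorbs the deviation (`exp_mul_mean_law_le`).

The Lipschitz bound rests on a spectral gap of order `1 / (n ^ 6 * k ^ 2)` in epoch `k`
(`gibbs_contracts`). Lift functions on tours to the symmetric group. Swapping two distant positions
amounts to two 2-opt moves, every transposition is a product of three such swaps, and every
permutation is a product of at most `n` transpositions. The triangle inequality in `L²` then gives a
Poincaré inequality for the squared chain (`poincare_twoOpt`). The prescribed epochs exceed the
relaxation time by enough to beat every power of `n ^ n` that is lost on the way. -/

namespace SimAnn

/-! ### Reversible Markov chains on a finite set -/

section Markov

variable {X : Type*} [Fintype X]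

/-- The mean of `f` with respect to the weights `p`. -/
def mean (p f : X → ℝ) : ℝ := ∑ x, p x * f x

/-- The `L²`-norm of `f` with respect to the weights `p`. -/
noncomputable def wnorm (p f : X → ℝ) : ℝ := √(∑ x, p x * f x ^ 2)

lemma wnorm_nonneg (p f : X → ℝ) : 0 ≤ wnorm p f := Real.sqrt_nonneg _

lemma wnorm_sq {p : X → ℝ} (hp : ∀ x, 0 ≤ p x) (f : X → ℝ) :
    wnorm p f ^ 2 = ∑ x, p x * f x ^ 2 :=
  Real.sq_sqrt (Finset.sum_nonneg fun x _ => mul_nonneg (hp x) (sq_nonneg _))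

lemma wnorm_eq_norm {p : X → ℝ} (hp : ∀ x, 0 ≤ p x) (f : X → ℝ) :
    wnorm p f = ‖WithLp.toLp 2 (fun x => √(p x) * f x)‖ := by
  rw [EuclideanSpace.norm_eq, wnorm]
  congr 1
  refine Finset.sum_congr rfl fun x _ => ?_
  rw [Real.norm_eq_abs, sq_abs, mul_pow, Real.sq_sqrt (hp x)]

lemma wnorm_add_le {p : X → ℝ} (hp : ∀ x, 0 ≤ p x) (f g : X → ℝ) :
    wnorm p (f + g) ≤ wnorm p f + wnorm p g := by
  rw [wnorm_eq_norm hp, wnorm_eq_norm hp, wnorm_eq_norm hp]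
  refine le_trans (le_of_eq ?_) (norm_add_le _ _)
  congr 1
  ext x
  simp [mul_add]

lemma wnorm_le_of_abs_le {p : X → ℝ} (hp : ∀ x, 0 ≤ p x) (h1 : ∑ x, p x = 1) {f : X → ℝ} {B : ℝ}
    (hB : 0 ≤ B) (hf : ∀ x, |f x| ≤ B) : wnorm p f ≤ B := by
  refine Real.sqrt_le_iff.2 ⟨hB, ?_⟩
  calc ∑ x, p x * f x ^ 2 ≤ ∑ x, p x * B ^ 2 := by
        refine Finset.sum_le_sum fun x _ => mul_le_mul_of_nonneg_left ?_ (hp x)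
        rw [← sq_abs]
        exact pow_le_pow_left₀ (abs_nonneg _) (hf x) 2
    _ = B ^ 2 := by rw [← Finset.sum_mul, h1, one_mul]

/-- Each passage from `L²` to pointwise bounds costs `1 / √κ`; the perturbation estimate below pays
it twice. -/
lemma abs_le_wnorm_div {p : X → ℝ} (hp : ∀ x, 0 ≤ p x) {κ : ℝ} (hκ : 0 < κ) {x : X}
    (hx : κ ≤ p x) (f : X → ℝ) : |f x| ≤ wnorm p f / √κ := by
  rw [le_div_iff₀ (Real.sqrt_pos.2 hκ)]
  refine Real.le_sqrt_of_sq_le ?_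
  rw [mul_pow, Real.sq_sqrt hκ.le, sq_abs]
  calc f x ^ 2 * κ ≤ p x * f x ^ 2 := by
        rw [mul_comm]; exact mul_le_mul_of_nonneg_right hx (sq_nonneg _)
    _ ≤ _ := Finset.single_le_sum (f := fun x => p x * f x ^ 2)
        (fun y _ => mul_nonneg (hp y) (sq_nonneg _)) (Finset.mem_univ x)

lemma mean_add (p f g : X → ℝ) : mean p (f + g) = mean p f + mean p g := by
  simp [mean, mul_add, Finset.sum_add_distrib]

lemma mean_sub (p f g : X → ℝ) : mean p (f - g) = mean p f - mean p g := by
  simp [mean, mul_sub, Finset.sum_sub_distrib]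

lemma mean_const {p : X → ℝ} (h1 : ∑ x, p x = 1) (c : ℝ) : mean p (fun _ => c) = c := by
  rw [mean, ← Finset.sum_mul, h1, one_mul]

lemma abs_mean_le {p : X → ℝ} (hp : ∀ x, 0 ≤ p x) (h1 : ∑ x, p x = 1) {f : X → ℝ} {B : ℝ}
    (hf : ∀ x, |f x| ≤ B) : |mean p f| ≤ B := by
  calc |mean p f| ≤ ∑ x, |p x * f x| := Finset.abs_sum_le_sum_abs _ _
    _ ≤ ∑ x, p x * B := by
        refine Finset.sum_le_sum fun x _ => ?_
        rw [abs_mul, abs_of_nonneg (hp x)]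
        exact mul_le_mul_of_nonneg_left (hf x) (hp x)
    _ = B := by rw [← Finset.sum_mul, h1, one_mul]

/-- The function `f` minus its mean. -/
def centered (p f : X → ℝ) : X → ℝ := fun x => f x - mean p f

lemma mean_centered {p : X → ℝ} (h1 : ∑ x, p x = 1) (f : X → ℝ) : mean p (centered p f) = 0 := by
  have : centered p f = f - fun _ => mean p f := rfl
  rw [this, mean_sub, mean_const h1, sub_self]

lemma centered_add (p f g : X → ℝ) : centered p (f + g) = centered p f + centered p g := by
  ext x
  simp only [centered, mean_add, Pi.add_apply]
  ring

/-- The mean minimises the quadratic deviation. -/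
lemma sum_centered_sq_le {p : X → ℝ} (h1 : ∑ x, p x = 1) (f : X → ℝ) (c : ℝ) :
    ∑ x, p x * centered p f x ^ 2 ≤ ∑ x, p x * (f x - c) ^ 2 := by
  have key : ∑ x, p x * (f x - c) ^ 2
      = ∑ x, p x * centered p f x ^ 2 + (mean p f - c) ^ 2 := by
    have h0 : ∑ x, p x * centered p f x = 0 := mean_centered h1 f
    calc ∑ x, p x * (f x - c) ^ 2
        = ∑ x, (p x * centered p f x ^ 2 + 2 * (mean p f - c) * (p x * centered p f x)
            + p x * (mean p f - c) ^ 2) := by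
          refine Finset.sum_congr rfl fun x _ => ?_
          simp only [centered]; ring
      _ = _ := by
          rw [Finset.sum_add_distrib, Finset.sum_add_distrib, ← Finset.mul_sum, h0,
            ← Finset.sum_mul, h1]
          ring
  rw [key]
  linarith [sq_nonneg (mean p f - c)]

lemma wnorm_centered_le {p : X → ℝ} (h1 : ∑ x, p x = 1) (f : X → ℝ) :
    wnorm p (centered p f) ≤ wnorm p f := by
  refine Real.sqrt_le_sqrt ?_
  simpa using sum_centered_sq_le h1 f 0

/-- A stochastic matrix `P` that is reversible with respect to the probability vector `p`. -/
structure Reversible (p : X → ℝ) (P : Matrix X X ℝ) : Prop where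
  weight_nonneg : ∀ x, 0 ≤ p x
  weight_sum : ∑ x, p x = 1
  entry_nonneg : ∀ x y, 0 ≤ P x y
  row_sum : ∀ x, ∑ y, P x y = 1
  balance : ∀ x y, p x * P x y = p y * P y x

lemma abs_mulVec_le {P : Matrix X X ℝ} (h0 : ∀ x y, 0 ≤ P x y) (h1 : ∀ x, ∑ y, P x y = 1)
    {f : X → ℝ} {B : ℝ} (hf : ∀ x, |f x| ≤ B) (x : X) : |(P *ᵥ f) x| ≤ B :=
  abs_mean_le (h0 x) (h1 x) hf

lemma mulVec_const {P : Matrix X X ℝ} (h1 : ∀ x, ∑ y, P x y = 1) (c : ℝ) :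
    (P *ᵥ fun _ => c) = fun _ => c := by
  ext x
  exact mean_const (h1 x) c

namespace Reversible

variable {p : X → ℝ} {P : Matrix X X ℝ}

lemma mean_mul_mulVec (h : Reversible p P) (f g : X → ℝ) :
    ∑ x, p x * (f x * (P *ᵥ g) x) = ∑ x, p x * ((P *ᵥ f) x * g x) := by
  simp only [Matrix.mulVec, dotProduct, Finset.mul_sum, Finset.sum_mul]
  rw [Finset.sum_comm]
  refine Finset.sum_congr rfl fun x _ => Finset.sum_congr rfl fun y _ => ?_
  linear_combination (f y * g x) * h.balance y x

lemma mean_mulVec (h : Reversible p P) (f : X → ℝ) : mean p (P *ᵥ f) = mean p f := by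
  have := h.mean_mul_mulVec (fun _ => 1) f
  rw [mulVec_const h.row_sum] at this
  simpa [mean] using this

lemma centered_mulVec (h : Reversible p P) (f : X → ℝ) :
    centered p (P *ᵥ f) = P *ᵥ centered p f := by
  have : centered p f = f - fun _ => mean p f := rfl
  rw [this, Matrix.mulVec_sub, mulVec_const h.row_sum]
  ext x
  simp [centered, h.mean_mulVec]

/-- The loss of `L²`-norm in one step is the Dirichlet form of `P * P`. Working with the square
controls eigenvalues near `-1` as well, so no laziness of the chain is needed. -/
lemma sum_sq_sub_sum_mulVec_sq (h : Reversible p P) (f : X → ℝ) :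
    ∑ x, p x * f x ^ 2 - ∑ x, p x * (P *ᵥ f) x ^ 2
      = (1 / 2) * ∑ x, ∑ y, p x * (P * P) x y * (f x - f y) ^ 2 := by
  classical
  have hPP : ∀ x, ∑ y, (P * P) x y = 1 := by
    intro x
    have h2 : ((P * P) *ᵥ fun _ => (1 : ℝ)) x = 1 := by
      rw [← Matrix.mulVec_mulVec, mulVec_const h.row_sum, mulVec_const h.row_sum]
    simpa [Matrix.mulVec, dotProduct] using h2
  have hbal : ∀ x y, p x * (P * P) x y = p y * (P * P) y x := by
    intro x y
    simp only [Matrix.mul_apply, Finset.mul_sum]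
    refine Finset.sum_congr rfl fun z _ => ?_
    linear_combination P z y * h.balance x z + P z x * h.balance z y
  have e1 : ∑ x, ∑ y, p x * (P * P) x y * f x ^ 2 = ∑ x, p x * f x ^ 2 := by
    refine Finset.sum_congr rfl fun x _ => ?_
    rw [← Finset.sum_mul, ← Finset.mul_sum, hPP, mul_one]
  have e2 : ∑ x, ∑ y, p x * (P * P) x y * f y ^ 2 = ∑ x, p x * f x ^ 2 := by
    rw [Finset.sum_comm, ← e1]
    refine Finset.sum_congr rfl fun x _ => Finset.sum_congr rfl fun y _ => ?_
    rw [hbal]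
  have e3 : ∑ x, ∑ y, p x * (P * P) x y * (f x * f y) = ∑ x, p x * (P *ᵥ f) x ^ 2 := by
    have := h.mean_mul_mulVec f (P *ᵥ f)
    simp only [← sq] at this
    rw [← this]
    refine Finset.sum_congr rfl fun x _ => ?_
    rw [Matrix.mulVec_mulVec]
    simp only [Matrix.mulVec, dotProduct, Finset.mul_sum]
    exact Finset.sum_congr rfl fun y _ => by ring
  have : ∀ x y, p x * (P * P) x y * (f x - f y) ^ 2 = p x * (P * P) x y * f x ^ 2
      + p x * (P * P) x y * f y ^ 2 - 2 * (p x * (P * P) x y * (f x * f y)) := fun x y => by ring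
  simp only [this, Finset.sum_sub_distrib, Finset.sum_add_distrib, ← Finset.mul_sum]
  rw [e1, e2, e3]
  ring

/-- A Poincaré inequality for the two-step chain gives an `L²`-contraction. -/
lemma wnorm_mulVec_le (h : Reversible p P) {γ ρ : ℝ} (hρ : 0 ≤ ρ) (hγ : 1 - γ ≤ ρ ^ 2)
    (hpoinc : ∀ f : X → ℝ, γ * ∑ x, p x * centered p f x ^ 2
      ≤ (1 / 2) * ∑ x, ∑ y, p x * (P * P) x y * (f x - f y) ^ 2) (f : X → ℝ) :
    wnorm p (P *ᵥ centered p f) ≤ ρ * wnorm p (centered p f) := by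
  refine abs_le_of_sq_le_sq' ?_ (mul_nonneg hρ (wnorm_nonneg _ _)) |>.2
  rw [mul_pow, wnorm_sq h.weight_nonneg, wnorm_sq h.weight_nonneg]
  have h1 := h.sum_sq_sub_sum_mulVec_sq (centered p f)
  have h2 := hpoinc f
  have h3 : ∀ x y, centered p f x - centered p f y = f x - f y := fun x y => by simp [centered]
  simp only [h3] at h1
  have h4 : 0 ≤ ∑ x, p x * centered p f x ^ 2 :=
    Finset.sum_nonneg fun x _ => mul_nonneg (h.weight_nonneg x) (sq_nonneg _)
  nlinarith

end Reversible

end Markov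

/-! ### Stability of convergence to equilibrium under perturbation of the chain -/

section Perturbation

variable {X : Type*} [Fintype X]

/-- `P` contracts centered functions in `L²(p)` by the factor `ρ`. -/
def Contracts (p : X → ℝ) (P : Matrix X X ℝ) (ρ : ℝ) : Prop :=
  ∀ f : X → ℝ, wnorm p (P *ᵥ centered p f) ≤ ρ * wnorm p (centered p f)

variable {p p' : X → ℝ} {P P' : Matrix X X ℝ} {ρ κ η : ℝ}

lemma abs_sub_mulVec_le (hη : ∀ x, ∑ y, |P' x y - P x y| ≤ η) {f : X → ℝ} {B : ℝ}
    (hB : 0 ≤ B) (hf : ∀ x, |f x| ≤ B) (x : X) : |((P' - P) *ᵥ f) x| ≤ η * B := by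
  calc |((P' - P) *ᵥ f) x| ≤ ∑ y, |(P' x y - P x y) * f y| := Finset.abs_sum_le_sum_abs _ _
    _ ≤ ∑ y, |P' x y - P x y| * B := by
        refine Finset.sum_le_sum fun y _ => ?_
        rw [abs_mul]
        exact mul_le_mul_of_nonneg_left (hf y) (abs_nonneg _)
    _ ≤ η * B := by
        rw [← Finset.sum_mul]
        exact mul_le_mul_of_nonneg_right (hη x) hB

lemma abs_mean_sub_mean_le (hη : ∑ x, |p' x - p x| ≤ η) {f : X → ℝ} {B : ℝ}
    (hB : 0 ≤ B) (hf : ∀ x, |f x| ≤ B) : |mean p' f - mean p f| ≤ η * B := by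
  have : mean p' f - mean p f = ∑ x, (p' x - p x) * f x := by
    simp [mean, sub_mul, Finset.sum_sub_distrib]
  rw [this]
  calc |∑ x, (p' x - p x) * f x| ≤ ∑ x, |(p' x - p x) * f x| := Finset.abs_sum_le_sum_abs _ _
    _ ≤ ∑ x, |p' x - p x| * B := by
        refine Finset.sum_le_sum fun x _ => ?_
        rw [abs_mul]
        exact mul_le_mul_of_nonneg_left (hf x) (abs_nonneg _)
    _ ≤ η * B := by
        rw [← Finset.sum_mul]
        exact mul_le_mul_of_nonneg_right hη hB

variable [DecidableEq X]

namespace Reversible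

lemma pow_mulVec_succ (P : Matrix X X ℝ) (j : ℕ) (f : X → ℝ) :
    P ^ (j + 1) *ᵥ f = P *ᵥ (P ^ j *ᵥ f) := by
  rw [pow_succ', Matrix.mulVec_mulVec]

lemma abs_pow_mulVec_le (h : Reversible p P) (j : ℕ) {f : X → ℝ} {B : ℝ} (hf : ∀ x, |f x| ≤ B)
    (x : X) : |(P ^ j *ᵥ f) x| ≤ B := by
  induction j generalizing x with
  | zero => simpa using hf x
  | succ j ih =>
    rw [pow_mulVec_succ]
    exact abs_mulVec_le h.entry_nonneg h.row_sum ih x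

lemma mean_pow_mulVec (h : Reversible p P) (j : ℕ) (f : X → ℝ) :
    mean p (P ^ j *ᵥ f) = mean p f := by
  induction j with
  | zero => simp
  | succ j ih => rw [pow_mulVec_succ, h.mean_mulVec, ih]

lemma wnorm_centered_pow_le (h : Reversible p P) (hc : Contracts p P ρ) (hρ : 0 ≤ ρ) (j : ℕ)
    (f : X → ℝ) :
    wnorm p (centered p (P ^ j *ᵥ f)) ≤ ρ ^ j * wnorm p (centered p f) := by
  induction j with
  | zero => simp
  | succ j ih =>
    rw [pow_mulVec_succ, h.centered_mulVec, pow_succ', mul_assoc]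
    exact (hc _).trans (mul_le_mul_of_nonneg_left ih hρ)

/-- Geometric convergence to the stationary mean, in the supremum norm. -/
lemma abs_pow_mulVec_sub_mean_le (h : Reversible p P) (hc : Contracts p P ρ) (hρ : 0 ≤ ρ)
    (hκ : 0 < κ) (hp : ∀ x, κ ≤ p x) (j : ℕ) {f : X → ℝ} (hf : ∀ x, |f x| ≤ 1) (x : X) :
    |(P ^ j *ᵥ f) x - mean p f| ≤ ρ ^ j / √κ := by
  have h1 := abs_le_wnorm_div h.weight_nonneg hκ (hp x) (centered p (P ^ j *ᵥ f))
  have h2 := h.wnorm_centered_pow_le hc hρ j f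
  have h3 : wnorm p (centered p f) ≤ 1 := (wnorm_centered_le h.weight_sum f).trans
    (wnorm_le_of_abs_le h.weight_nonneg h.weight_sum zero_le_one hf)
  have e : (P ^ j *ᵥ f) x - mean p f = centered p (P ^ j *ᵥ f) x := by
    simp only [centered, h.mean_pow_mulVec]
  rw [e]
  refine h1.trans ?_
  gcongr
  refine h2.trans ?_
  exact mul_le_of_le_one_right (pow_nonneg hρ _) h3

/-- The deviation from stationarity depends on the chain in a Lipschitz way, with a constant that
decays geometrically in the number of steps. -/
lemma abs_deviation_sub_deviation_le (h : Reversible p P) (h' : Reversible p' P')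
    (hc : Contracts p P ρ) (hc' : Contracts p' P' ρ) (hρ : 0 ≤ ρ) (hρ1 : ρ ≤ 1)
    (hκ : 0 < κ) (hκ1 : κ ≤ 1) (hp : ∀ x, κ ≤ p x) (hp' : ∀ x, κ ≤ p' x) (hη0 : 0 ≤ η)
    (hη : ∀ x, ∑ y, |P' x y - P x y| ≤ η) (hηp : ∑ x, |p' x - p x| ≤ η)
    (j : ℕ) {f : X → ℝ} (hf : ∀ x, |f x| ≤ 1) (x : X) :
    |((P' ^ j *ᵥ f) x - mean p' f) - ((P ^ j *ᵥ f) x - mean p f)|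
      ≤ η * ((j + 1) * ρ ^ (j - 1) / κ) := by
  set d : ℕ → X → ℝ := fun j x => ((P' ^ j *ᵥ f) x - mean p' f) - ((P ^ j *ᵥ f) x - mean p f)
    with hd
  set g : ℕ → X → ℝ := fun j x => (P ^ j *ᵥ f) x - mean p f with hg
  have hs : 0 < √κ := Real.sqrt_pos.2 hκ
  have hgb : ∀ j x, |g j x| ≤ ρ ^ j / √κ := fun j x =>
    h.abs_pow_mulVec_sub_mean_le hc hρ hκ hp j hf x
  have hBn : ∀ j, 0 ≤ ρ ^ j / √κ := fun j => div_nonneg (pow_nonneg hρ _) hs.le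
  -- The difference `d` of the two deviations obeys a linear recursion driven by `P'`, whose source
  -- `(P' - P) *ᵥ g j` is small by `η` and decays geometrically through `g`.
  have hrec : ∀ j, d (j + 1) = P' *ᵥ d j + (P' - P) *ᵥ g j := by
    intro j
    have e1 : d j = P' ^ j *ᵥ f - (fun _ => mean p' f) - g j := by ext x; simp [hd, hg]
    have e2 : g j = P ^ j *ᵥ f - (fun _ => mean p f) := by ext x; simp [hg]
    rw [Matrix.sub_mulVec, e1, Matrix.mulVec_sub, Matrix.mulVec_sub, mulVec_const h'.row_sum, e2,
      Matrix.mulVec_sub P, mulVec_const h.row_sum]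
    ext x
    simp only [hd, pow_mulVec_succ, Pi.add_apply, Pi.sub_apply]
    ring
  -- Each of the `j` sources has decayed to total order `ρ ^ (j - 1)`. For `j = 0` the truncated
  -- exponent is harmless because of the factor `j`.
  have hcent : ∀ j, wnorm p' (centered p' (d j)) ≤ j * η * (ρ ^ (j - 1) / √κ) := by
    intro j
    induction j with
    | zero =>
      have : centered p' (d 0) = fun _ => 0 := by
        ext x
        have e : d 0 = fun _ => mean p f - mean p' f := by
          ext x; simp [hd]
        rw [e]
        simp [centered, mean_const h'.weight_sum]
      rw [this]
      simp [wnorm]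
    | succ j ih =>
      rw [hrec, centered_add, h'.centered_mulVec]
      refine (wnorm_add_le h'.weight_nonneg _ _).trans ?_
      have i1 : wnorm p' (P' *ᵥ centered p' (d j)) ≤ j * η * (ρ ^ j / √κ) := by
        refine (hc' _).trans ((mul_le_mul_of_nonneg_left ih hρ).trans (le_of_eq ?_))
        rcases j with _ | j
        · simp
        · simp only [Nat.add_sub_cancel, pow_succ]; ring
      have i2 : wnorm p' (centered p' ((P' - P) *ᵥ g j)) ≤ η * (ρ ^ j / √κ) :=
        (wnorm_centered_le h'.weight_sum _).trans (wnorm_le_of_abs_le h'.weight_nonneg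
          h'.weight_sum (mul_nonneg hη0 (hBn j)) (abs_sub_mulVec_le hη (hBn j) (hgb j)))
      refine (add_le_add i1 i2).trans (le_of_eq ?_)
      push_cast
      ring
  -- `P'` does not contract constants, so the mean of `d j` is treated apart: `g j` has mean zero
  -- under `p`, hence mean of order `η` under `p'`.
  have hmean : |mean p' (d j)| ≤ η * (ρ ^ j / √κ) := by
    have e1 : d j = P' ^ j *ᵥ f - (fun _ => mean p' f) - g j := by ext x; simp [hd, hg]
    have e2 : g j = P ^ j *ᵥ f - (fun _ => mean p f) := by ext x; simp [hg]
    have e3 : mean p' (d j) = -(mean p' (g j) - mean p (g j)) := by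
      have e4 : mean p (g j) = 0 := by
        rw [e2, mean_sub, mean_const h.weight_sum, h.mean_pow_mulVec, sub_self]
      rw [e4, e1, mean_sub, mean_sub, mean_const h'.weight_sum, h'.mean_pow_mulVec]
      ring
    rw [e3, abs_neg]
    exact abs_mean_sub_mean_le hηp (hBn j) (hgb j)
  have hsplit : d j x = centered p' (d j) x + mean p' (d j) := by simp [centered]
  have hfin : |d j x| ≤ j * η * (ρ ^ (j - 1) / √κ) / √κ + η * (ρ ^ j / √κ) := by
    rw [hsplit]
    refine (abs_add_le _ _).trans (add_le_add ?_ hmean)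
    exact (abs_le_wnorm_div h'.weight_nonneg hκ (hp' x) _).trans (by gcongr; exact hcent j)
  refine hfin.trans ?_
  have e1 : j * η * (ρ ^ (j - 1) / √κ) / √κ = j * η * (ρ ^ (j - 1) / κ) := by
    have := Real.mul_self_sqrt hκ.le
    rw [mul_div_assoc, div_div, this]
  have e2 : ρ ^ j / √κ ≤ ρ ^ (j - 1) / κ := by
    refine div_le_div₀ (pow_nonneg hρ _) (pow_le_pow_of_le_one hρ hρ1 (Nat.sub_le _ _)) hκ ?_
    refine Real.le_sqrt_of_sq_le ?_
    nlinarith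
  rw [e1]
  calc j * η * (ρ ^ (j - 1) / κ) + η * (ρ ^ j / √κ)
      ≤ j * η * (ρ ^ (j - 1) / κ) + η * (ρ ^ (j - 1) / κ) := by gcongr
    _ = _ := by ring

end Reversible

end Perturbation

/-! ### Tours as cyclic orderings of the nodes -/

section Tours

variable {n : ℕ}

/-- Two positions on a cycle of length `n` are adjacent. -/
def CycAdj (i j : Fin n) : Prop :=
  i.1 + 1 = j.1 ∨ j.1 + 1 = i.1 ∨ (i.1 = 0 ∧ j.1 + 1 = n) ∨ (j.1 = 0 ∧ i.1 + 1 = n)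

/-- The edges of a tour, as unordered pairs of nodes. -/
def edges (x : Tour n) : Finset (Sym2 (Fin n)) := x.1.map (Function.Embedding.subtype _)

lemma mem_edges {x : Tour n} {e : Sym2 (Fin n)} : e ∈ edges x ↔ ∃ e' ∈ x.1, e'.1 = e := by
  simp [edges]

lemma edges_injective : Function.Injective (edges (n := n)) := fun _ _ h =>
  Subtype.ext (Finset.map_injective _ h)

lemma card_edges (x : Tour n) : (edges x).card = x.1.card := Finset.card_map _

lemma edges_sdiff (x y : Tour n) : (edges x \ edges y).card = (x.1 \ y.1).card := by
  classical
  have : edges x \ edges y = (x.1 \ y.1).map (Function.Embedding.subtype _) := by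
    ext e
    simp only [edges, Finset.mem_sdiff, Finset.mem_map, Function.Embedding.subtype_apply]
    constructor
    · rintro ⟨⟨a, ha, rfl⟩, h⟩
      exact ⟨a, ⟨ha, fun hy => h ⟨a, hy, rfl⟩⟩, rfl⟩
    · rintro ⟨a, ⟨ha, hb⟩, rfl⟩
      refine ⟨⟨a, ha, rfl⟩, ?_⟩
      rintro ⟨b, hy, hab⟩
      exact hb (Subtype.ext hab ▸ hy)
  rw [this, Finset.card_map]

lemma mem_twoOpt {x y : Tour n} : y ∈ twoOpt x ↔ (edges x \ edges y).card = 2 := by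
  rw [edges_sdiff]; simp [twoOpt]

/-- The ordering `σ` of the nodes runs through the tour `x`. -/
def Traverses (σ : Equiv.Perm (Fin n)) (x : Tour n) : Prop :=
  ∀ i j, s(σ i, σ j) ∈ edges x ↔ CycAdj i j

lemma mem_edges_iff_of_walk {x : Tour n} {v : Fin n} {p : (⊤ : SimpleGraph (Fin n)).Walk v v}
    (h : ∀ e : Edge n, e ∈ x.1 ↔ (e : Sym2 (Fin n)) ∈ p.edges) (e : Sym2 (Fin n)) :
    e ∈ edges x ↔ e ∈ p.edges := by
  rw [mem_edges]
  constructor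
  · rintro ⟨e', he', rfl⟩
    exact (h e').1 he'
  · intro he
    exact ⟨⟨e, p.edges_subset_edgeSet he⟩, (h _).2 he, rfl⟩

lemma three_le (x : Tour n) : 3 ≤ n := by
  obtain ⟨v, p, hp, -⟩ := x.2
  have := hp.isCycle.three_le_length
  rwa [hp.length_eq, Fintype.card_fin] at this

lemma card_tour (x : Tour n) : x.1.card = n := by
  obtain ⟨v, p, hp, h⟩ := x.2
  rw [← card_edges]
  have : edges x = p.edges.toFinset := by
    ext e
    rw [mem_edges_iff_of_walk h, List.mem_toFinset]
  rw [this, List.toFinset_card_of_nodup hp.isCycle.edges_nodup, SimpleGraph.Walk.length_edges,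
    hp.length_eq, Fintype.card_fin]

lemma exists_traverses (x : Tour n) : ∃ σ, Traverses σ x := by
  have hn := three_le x
  obtain ⟨v, p, hp, h⟩ := x.2
  have hlen : p.length = n := by rw [hp.length_eq, Fintype.card_fin]
  have hinj : Function.Injective fun i : Fin n => p.getVert i := fun i j hij => Fin.ext
    (hp.isCycle.getVert_injOn' (by simp only [Set.mem_ofPred_eq]; omega)
      (by simp only [Set.mem_ofPred_eq]; omega) hij)
  have hend' : ∀ m, m = p.length → p.getVert m = p.getVert 0 := by
    rintro _ rfl
    rw [p.getVert_length, p.getVert_zero]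
  have hend : p.getVert n = p.getVert 0 := hend' n hlen.symm
  refine ⟨Equiv.ofBijective _ (Finite.injective_iff_bijective.1 hinj), fun i j => ?_⟩
  rw [mem_edges_iff_of_walk h]
  simp only [Equiv.ofBijective_apply]
  rw [SimpleGraph.Walk.mk_mem_edges_iff_exists, hlen]
  have hval : ∀ a b : ℕ, a < n → b < n → p.getVert a = p.getVert b → a = b := fun a b ha hb hab =>
    congrArg Fin.val (hinj (a₁ := ⟨a, ha⟩) (a₂ := ⟨b, hb⟩) hab)
  constructor
  · rintro ⟨k, hk, hkk⟩
    rw [Sym2.eq_iff] at hkk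
    by_cases hk1 : k + 1 < n
    · rcases hkk with ⟨h1, h2⟩ | ⟨h1, h2⟩
      · have := hval _ _ hk i.2 h1
        have := hval _ _ hk1 j.2 h2
        unfold CycAdj; omega
      · have := hval _ _ hk j.2 h1
        have := hval _ _ hk1 i.2 h2
        unfold CycAdj; omega
    -- The closing edge of the cycle, from position `n - 1` back to position `0`.
    · have hk2 : k + 1 = n := by omega
      rw [hk2, hend] at hkk
      rcases hkk with ⟨h1, h2⟩ | ⟨h1, h2⟩
      · have := hval _ _ hk i.2 h1
        have := hval _ _ (by omega) j.2 h2
        unfold CycAdj; omega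
      · have := hval _ _ hk j.2 h1
        have := hval _ _ (by omega) i.2 h2
        unfold CycAdj; omega
  · rintro (h1 | h1 | ⟨h1, h2⟩ | ⟨h1, h2⟩)
    · exact ⟨i, i.2, by rw [h1]⟩
    · exact ⟨j, j.2, by rw [h1, Sym2.eq_swap]⟩
    · exact ⟨j, j.2, by rw [h2, hend, h1, Sym2.eq_swap]⟩
    · exact ⟨i, i.2, by rw [h2, hend, h1]⟩

lemma Traverses.mem_iff {σ : Equiv.Perm (Fin n)} {x : Tour n} (h : Traverses σ x) (a b : Fin n) :
    s(a, b) ∈ edges x ↔ CycAdj (σ⁻¹ a) (σ⁻¹ b) := by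
  simpa using h (σ⁻¹ a) (σ⁻¹ b)

lemma Traverses.unique {σ : Equiv.Perm (Fin n)} {x y : Tour n} (hx : Traverses σ x)
    (hy : Traverses σ y) : x = y := by
  refine edges_injective (Finset.ext fun e => ?_)
  induction e using Sym2.ind with
  | _ a b => rw [hx.mem_iff, hy.mem_iff]

/-- The action of a permutation of the nodes on the edges. -/
def relabelEdge (g : Equiv.Perm (Fin n)) : Edge n ≃ Edge n :=
  (SimpleGraph.Iso.completeGraph g).mapEdgeSet

lemma coe_relabelEdge (g : Equiv.Perm (Fin n)) (e : Edge n) :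
    (relabelEdge g e : Sym2 (Fin n)) = Sym2.map g e := rfl

/-- The tour obtained by renaming the nodes. -/
def relabel (g : Equiv.Perm (Fin n)) (x : Tour n) : Tour n :=
  ⟨x.1.map (relabelEdge g).toEmbedding, by
    obtain ⟨v, p, hp, h⟩ := x.2
    refine ⟨_, p.map (SimpleGraph.Iso.completeGraph g).toHom, hp.map g.bijective, fun e => ?_⟩
    rw [SimpleGraph.Walk.edges_map, Finset.mem_map_equiv, h, List.mem_map]
    constructor
    · intro he
      refine ⟨_, he, ?_⟩
      have := coe_relabelEdge g ((relabelEdge g).symm e)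
      rw [Equiv.apply_symm_apply] at this
      exact this.symm
    · rintro ⟨e', he', hee⟩
      have : (relabelEdge g).symm e = ⟨e', p.edges_subset_edgeSet he'⟩ := by
        rw [Equiv.symm_apply_eq]
        exact Subtype.ext (by rw [coe_relabelEdge]; exact hee.symm)
      rw [this]
      exact he'⟩

lemma Traverses.relabel {σ : Equiv.Perm (Fin n)} {x : Tour n} (h : Traverses σ x)
    (g : Equiv.Perm (Fin n)) : Traverses (g * σ) (relabel g x) := by
  intro i j
  rw [← h i j, mem_edges, mem_edges]
  have key : ∀ e : Edge n, e.1 = s(σ i, σ j) ↔ (relabelEdge g e).1 = s((g * σ) i, (g * σ) j) := by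
    intro e
    rw [coe_relabelEdge, Equiv.Perm.mul_apply, Equiv.Perm.mul_apply, ← Sym2.map_mk]
    exact ((Sym2.map.injective g.injective).eq_iff).symm
  constructor
  · rintro ⟨e, he, hee⟩
    rw [SimAnn.relabel, Finset.mem_map_equiv] at he
    exact ⟨_, he, by rw [key, Equiv.apply_symm_apply]; exact hee⟩
  · rintro ⟨e, he, hee⟩
    exact ⟨relabelEdge g e, by simpa [SimAnn.relabel] using he, (key e).1 hee⟩

lemma relabel_injective (g : Equiv.Perm (Fin n)) : Function.Injective (relabel g) := by
  intro x y h
  exact Subtype.ext (Finset.map_injective _ (congrArg Subtype.val h))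

lemma relabel_sdiff (g : Equiv.Perm (Fin n)) (x y : Tour n) :
    ((relabel g x).1 \ (relabel g y).1).card = (x.1 \ y.1).card := by
  classical
  have : (relabel g x).1 \ (relabel g y).1 = (x.1 \ y.1).map (relabelEdge g).toEmbedding := by
    ext e
    simp only [relabel, Finset.mem_sdiff, Finset.mem_map_equiv]
  rw [this, Finset.card_map]

/-- Transitivity of the symmetric group on tours is the source of the regularity of the 2-opt graph
and of the equidistribution of orderings over tours. -/
lemma exists_relabel_eq (x y : Tour n) : ∃ g, relabel g x = y := by
  obtain ⟨σ, hσ⟩ := exists_traverses x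
  obtain ⟨τ, hτ⟩ := exists_traverses y
  refine ⟨τ * σ⁻¹, (hσ.relabel _).unique ?_⟩
  simpa using hτ

lemma exists_tour_traversed (x₀ : Tour n) (σ : Equiv.Perm (Fin n)) : ∃ x, Traverses σ x := by
  obtain ⟨τ, hτ⟩ := exists_traverses x₀
  refine ⟨relabel (σ * τ⁻¹) x₀, ?_⟩
  simpa using hτ.relabel (σ * τ⁻¹)

/-- The 2-opt graph is regular. -/
lemma card_twoOpt_eq (x y : Tour n) : (twoOpt x).card = (twoOpt y).card := by
  have key : ∀ x y : Tour n, (twoOpt x).card ≤ (twoOpt y).card := by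
    intro x y
    obtain ⟨g, rfl⟩ := exists_relabel_eq x y
    refine Finset.card_le_card_of_injOn (relabel g) (fun z hz => ?_)
      (relabel_injective g).injOn
    simp only [twoOpt, Finset.coe_filter, Finset.mem_univ, true_and, Set.mem_ofPred_eq] at hz ⊢
    rw [relabel_sdiff, hz]
  exact le_antisymm (key x y) (key y x)

lemma mem_twoOpt_comm {x y : Tour n} : y ∈ twoOpt x ↔ x ∈ twoOpt y := by
  have h : (x.1 \ y.1).card = (y.1 \ x.1).card := by
    rw [Finset.card_sdiff_comm]
    rw [card_tour, card_tour]
  simp [twoOpt, h]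

lemma not_mem_twoOpt_self (x : Tour n) : x ∉ twoOpt x := by
  simp [twoOpt]

end Tours

/-! ### 2-opt moves: their number, segment reversals, and exchanges of two nodes -/

section TwoOptMoves

variable {n : ℕ}

/-- The successor of a position on the cycle. -/
def cycSucc (i : Fin n) : Fin n := ⟨if i.1 + 1 = n then 0 else i.1 + 1, by split_ifs <;> omega⟩

/-- The predecessor of a position on the cycle. -/
def cycPred (i : Fin n) : Fin n := ⟨if i.1 = 0 then n - 1 else i.1 - 1, by split_ifs <;> omega⟩

lemma cycAdj_iff (i j : Fin n) : CycAdj i j ↔ j = cycSucc i ∨ j = cycPred i := by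
  simp only [CycAdj, cycSucc, cycPred, Fin.ext_iff]
  split_ifs <;> omega

/-- Every node has degree two in a tour. -/
lemma card_edges_filter_mem (x : Tour n) (u : Fin n) :
    ((edges x).filter (u ∈ ·)).card = 2 := by
  have hn := three_le x
  obtain ⟨σ, hσ⟩ := exists_traverses x
  obtain ⟨k, rfl⟩ := σ.surjective u
  have : (edges x).filter (σ k ∈ ·) = {s(σ k, σ (cycSucc k)), s(σ k, σ (cycPred k))} := by
    ext e
    simp only [Finset.mem_filter, Finset.mem_insert, Finset.mem_singleton]
    constructor
    · rintro ⟨he, hk⟩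
      obtain ⟨b, rfl⟩ := Sym2.mem_iff_exists.1 hk
      obtain ⟨j, rfl⟩ := σ.surjective b
      rw [hσ, cycAdj_iff] at he
      rcases he with rfl | rfl <;> simp
    · rintro (rfl | rfl)
      · exact ⟨(hσ _ _).2 ((cycAdj_iff _ _).2 (Or.inl rfl)), by simp⟩
      · exact ⟨(hσ _ _).2 ((cycAdj_iff _ _).2 (Or.inr rfl)), by simp⟩
  rw [this, Finset.card_pair]
  intro h
  rw [Sym2.congr_right, σ.injective.eq_iff] at h
  simp only [cycSucc, cycPred, Fin.ext_iff] at h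
  split_ifs at h <;> omega

/-- All degrees are two in both tours, so a node that gains an edge must also lose one. Hence the
new edges of a 2-opt move live on the at most four endpoints of the removed ones. -/
lemma mem_sdiff_of_mem_sdiff {x y : Tour n} {e : Sym2 (Fin n)} (he : e ∈ edges y \ edges x)
    {u : Fin n} (hu : u ∈ e) : ∃ e' ∈ edges x \ edges y, u ∈ e' := by
  by_contra hcon
  push Not at hcon
  rw [Finset.mem_sdiff] at he
  have hsub : insert e ((edges x).filter (u ∈ ·)) ⊆ (edges y).filter (u ∈ ·) := by
    intro e' h
    rw [Finset.mem_insert] at h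
    rcases h with rfl | h
    · exact Finset.mem_filter.2 ⟨he.1, hu⟩
    · rw [Finset.mem_filter] at h ⊢
      refine ⟨?_, h.2⟩
      by_contra hy
      exact hcon e' (Finset.mem_sdiff.2 ⟨h.1, hy⟩) h.2
  have hc := Finset.card_le_card hsub
  rw [Finset.card_insert_of_notMem (fun h => he.2 (Finset.mem_filter.1 h).1),
    card_edges_filter_mem, card_edges_filter_mem] at hc
  omega

/-- A tour has at most `1024 n²` neighbors. -/
lemma card_twoOpt_le (x : Tour n) : (twoOpt x).card ≤ 1024 * n ^ 2 := by
  classical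
  let V : Finset (Sym2 (Fin n)) → Finset (Fin n) := fun R => R.biUnion Sym2.toFinset
  let S : Finset (Σ _ : Finset (Sym2 (Fin n)), Finset (Sym2 (Fin n))) :=
    ((edges x).powersetCard 2).sigma fun R => (V R).sym2.powerset
  have hS : S.card ≤ 1024 * n ^ 2 := by
    rw [Finset.card_sigma]
    calc ∑ R ∈ (edges x).powersetCard 2, ((V R).sym2.powerset).card
        ≤ ∑ R ∈ (edges x).powersetCard 2, 1024 := by
          refine Finset.sum_le_sum fun R hR => ?_
          have hV : (V R).card ≤ 4 := by
            have h1 : (V R).card ≤ R.card * 2 := Finset.card_biUnion_le_card_mul _ _ _ fun e _ => by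
              rw [Sym2.card_toFinset]; split_ifs <;> omega
            rw [(Finset.mem_powersetCard.1 hR).2] at h1
            exact h1
          rw [Finset.card_powerset, Finset.card_sym2]
          -- Four nodes span `10` unordered pairs, loops included, hence at most `2 ^ 10` sets of
          -- new edges.
          calc 2 ^ ((V R).card + 1).choose 2 ≤ 2 ^ (4 + 1).choose 2 :=
                Nat.pow_le_pow_right (by norm_num) (Nat.choose_le_choose _ (by omega))
            _ = 1024 := by decide
      _ = n.choose 2 * 1024 := by
          rw [Finset.sum_const, Finset.card_powersetCard, card_edges, card_tour, smul_eq_mul]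
      _ ≤ 1024 * n ^ 2 := by
          rw [mul_comm]
          exact Nat.mul_le_mul_left _ (Nat.choose_le_pow n 2)
  refine le_trans ?_ hS
  refine Finset.card_le_card_of_injOn (fun y => ⟨edges x \ edges y, edges y \ edges x⟩) ?_ ?_
  · intro y hy
    rw [Finset.mem_coe, mem_twoOpt] at hy
    rw [Finset.mem_coe, Finset.mem_sigma, Finset.mem_powersetCard, Finset.mem_powerset]
    refine ⟨⟨Finset.sdiff_subset, hy⟩, fun e he => ?_⟩
    rw [Finset.mem_sym2_iff]
    intro u hu
    obtain ⟨e', he', hue⟩ := mem_sdiff_of_mem_sdiff he hu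
    exact Finset.mem_biUnion.2 ⟨e', he', Sym2.mem_toFinset.2 hue⟩
  · intro y _ z _ h
    simp only [Sigma.mk.injEq, heq_eq_eq] at h
    refine edges_injective ?_
    have key : ∀ w : Tour n, edges w = (edges x \ (edges x \ edges w)) ∪ (edges w \ edges x) := by
      intro w
      ext e
      simp only [Finset.mem_union, Finset.mem_sdiff]
      tauto
    rw [key y, key z, h.1, h.2]

/-- The reversal of the positions `i, …, j`. -/
def reversal (i j : Fin n) : Equiv.Perm (Fin n) :=
  Function.Involutive.toPerm
    (fun k => if h : i.1 ≤ k.1 ∧ k.1 ≤ j.1 then ⟨i.1 + j.1 - k.1, by omega⟩ else k)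
    (by
      intro k
      by_cases h : i.1 ≤ k.1 ∧ k.1 ≤ j.1
      · simp only [Fin.ext_iff, h, and_self, dite_true]
        rw [dif_pos (by omega)]
        dsimp only
        omega
      · simp only [dif_neg h])

lemma reversal_val (i j k : Fin n) :
    (reversal i j k).1 = if i.1 ≤ k.1 ∧ k.1 ≤ j.1 then i.1 + j.1 - k.1 else k.1 := by
  change (if h : i.1 ≤ k.1 ∧ k.1 ≤ j.1 then (⟨i.1 + j.1 - k.1, by omega⟩ : Fin n) else k).1 = _
  split_ifs <;> rfl

lemma reversal_inv (i j : Fin n) : (reversal i j)⁻¹ = reversal i j :=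
  Function.Involutive.toPerm_symm _

/-- Reversing a segment of a tour is a 2-opt move. -/
lemma mem_twoOpt_of_reversal {x y : Tour n} {σ : Equiv.Perm (Fin n)} {i j : Fin n} (hij : i < j)
    (hlen : j.1 + 3 ≤ i.1 + n) (hx : Traverses σ x) (hy : Traverses (σ * reversal i j) y) :
    y ∈ twoOpt x := by
  have hn := three_le x
  have hij' : i.1 < j.1 := hij
  rw [mem_twoOpt]
  -- Only the two edges at the ends of the reversed segment disappear. There are at least two
  -- positions inside the segment and, by `hlen`, at least two outside, so neither edge reappears.
  have : edges x \ edges y = {s(σ (cycPred i), σ i), s(σ j, σ (cycSucc j))} := by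
    ext e
    induction e using Sym2.ind with
    | _ a b =>
    obtain ⟨a, rfl⟩ := σ.surjective a
    obtain ⟨b, rfl⟩ := σ.surjective b
    simp only [Finset.mem_sdiff, Finset.mem_insert, Finset.mem_singleton, Sym2.eq_iff,
      σ.injective.eq_iff]
    rw [hx, hy.mem_iff, mul_inv_rev, reversal_inv]
    have hinv : ∀ c, (reversal i j * σ⁻¹) (σ c) = reversal i j c := fun c => by simp
    rw [hinv, hinv]
    have ha := a.2
    have hb := b.2
    have hj := j.2
    have hp : (i.1 = 0 ∧ (cycPred i).1 + 1 = n) ∨ (cycPred i).1 + 1 = i.1 := by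
      simp only [cycPred]; split_ifs <;> omega
    have hq : (j.1 + 1 = n ∧ (cycSucc j).1 = 0) ∨ ((cycSucc j).1 = j.1 + 1 ∧ j.1 + 1 < n) := by
      simp only [cycSucc]; split_ifs <;> omega
    simp only [CycAdj, reversal_val, Fin.ext_iff]
    generalize (cycPred i).1 = p at *
    generalize (cycSucc j).1 = q at *
    by_cases h1 : i.1 ≤ a.1 ∧ a.1 ≤ j.1 <;> by_cases h2 : i.1 ≤ b.1 ∧ b.1 ≤ j.1
    · rw [if_pos h1, if_pos h2]
      refine iff_of_false (fun h => h.2 ?_) (by omega)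
      rcases h.1 with h3 | h3 | h3 | h3 <;> omega
    · rw [if_pos h1, if_neg h2]
      constructor
      · rintro ⟨h3 | h3 | h3 | h3, -⟩ <;> omega
      · rintro ((h3 | h3) | (h3 | h3)) <;> refine ⟨by omega, ?_⟩ <;>
          rintro (h4 | h4 | h4 | h4) <;> omega
    · rw [if_neg h1, if_pos h2]
      constructor
      · rintro ⟨h3 | h3 | h3 | h3, -⟩ <;> omega
      · rintro ((h3 | h3) | (h3 | h3)) <;> refine ⟨by omega, ?_⟩ <;>
          rintro (h4 | h4 | h4 | h4) <;> omega
    · rw [if_neg h1, if_neg h2]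
      refine iff_of_false (fun h => h.2 h.1) ?_
      omega
  rw [this, Finset.card_pair]
  intro h
  simp only [Sym2.eq_iff, σ.injective.eq_iff, cycPred, cycSucc, Fin.ext_iff] at h
  split_ifs at h <;> omega

/-- Two positions are far apart on the cycle. -/
def FarApart (i j : Fin n) : Prop := i.1 + 3 ≤ j.1 ∧ j.1 + 3 ≤ i.1 + n

/-- Exchanging the nodes at two positions that are far apart takes two 2-opt moves. -/
lemma exists_twoOpt_twoOpt_of_swap {x y : Tour n} {σ : Equiv.Perm (Fin n)} {i j : Fin n}
    (hij : FarApart i j) (hx : Traverses σ x) (hy : Traverses (σ * Equiv.swap i j) y) :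
    ∃ z, z ∈ twoOpt x ∧ y ∈ twoOpt z := by
  obtain ⟨h1, h2⟩ := hij
  have hj := j.2
  obtain ⟨z, hz⟩ := exists_tour_traversed x (σ * reversal i j)
  -- Reverse the segment `i, …, j`, then its interior `i + 1, …, j - 1`: the interior is restored
  -- and only the two end nodes are exchanged.
  refine ⟨z, mem_twoOpt_of_reversal (show i.1 < j.1 by omega) h2 hx hz,
    mem_twoOpt_of_reversal (i := ⟨i.1 + 1, by omega⟩) (j := ⟨j.1 - 1, by omega⟩)
    (show i.1 + 1 < j.1 - 1 by omega) (by dsimp only; omega) hz ?_⟩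
  convert hy using 1
  rw [mul_assoc]
  congr 1
  ext k
  rw [Equiv.Perm.mul_apply, reversal_val, reversal_val, Equiv.swap_apply_def]
  simp only [Fin.ext_iff]
  split_ifs <;> simp_all <;> omega

end TwoOptMoves

/-! ### A Poincaré inequality for two-step chains on tours -/

section Poincare

variable {n : ℕ}

/-- A subadditive function on permutations is bounded through its values on transpositions. -/
lemma le_card_support_mul {N : Equiv.Perm (Fin n) → ℝ} {c : ℝ} (h1 : N 1 ≤ 0)
    (hmul : ∀ g h, N (g * h) ≤ N g + N h) (hswap : ∀ i j, i ≠ j → N (Equiv.swap i j) ≤ c)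
    (g : Equiv.Perm (Fin n)) : N g ≤ g.support.card * c := by
  induction hk : g.support.card using Nat.strong_induction_on generalizing g with
  | _ k ih =>
    by_cases hg : g = 1
    · subst hg
      simp only [Equiv.Perm.support_one, Finset.card_empty] at hk
      simpa [← hk] using h1
    · obtain ⟨i, hi⟩ : ∃ i, g i ≠ i := by
        by_contra hcon
        push Not at hcon
        exact hg (Equiv.ext hcon)
      have hlt := Equiv.Perm.card_support_swap_mul hi
      have hle := ih _ (hk ▸ hlt) _ rfl
      -- Subadditivity gives `0 ≤ N 1 ≤ 2 * c`, as a transposition squares to `1`.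
      have hc : 0 ≤ c := by
        have e1 := hmul (Equiv.swap i (g i)) (Equiv.swap i (g i))
        have e2 := hmul 1 1
        rw [one_mul] at e2
        rw [Equiv.swap_mul_self] at e1
        linarith [hswap _ _ hi.symm]
      have hsplit : g = Equiv.swap i (g i) * (Equiv.swap i (g i) * g) := by
        rw [← mul_assoc, Equiv.swap_mul_self, one_mul]
      have hlt' : (((Equiv.swap i (g i) * g).support.card : ℕ) : ℝ) + 1 ≤ k := by
        exact_mod_cast (hk ▸ hlt)
      calc N g ≤ N (Equiv.swap i (g i)) + N (Equiv.swap i (g i) * g) := by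
            conv_lhs => rw [hsplit]
            exact hmul _ _
        _ ≤ c + ((Equiv.swap i (g i) * g).support.card : ℕ) * c :=
            add_le_add (hswap _ _ hi.symm) hle
        _ = ((((Equiv.swap i (g i) * g).support.card : ℕ) : ℝ) + 1) * c := by ring
        _ ≤ k * c := mul_le_mul_of_nonneg_right hlt' hc

/-- The positions `0`, `5`, `10` have cyclic distances at least `5`, so each of `i` and `j` is
within distance `2` of at most one of them, and one of the three stays free. -/
lemma exists_farApart (hn : 15 ≤ n) (i j : Fin n) :
    ∃ k, (FarApart i k ∨ FarApart k i) ∧ (FarApart j k ∨ FarApart k j) := by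
  have hi := i.2
  have hj := j.2
  by_contra hcon
  push Not at hcon
  have h0 := hcon ⟨0, by omega⟩
  have h5 := hcon ⟨5, by omega⟩
  have h10 := hcon ⟨10, by omega⟩
  simp only [FarApart] at h0 h5 h10
  omega

/-- Conjugation: `(i j) = (k j)(i k)(k j)` with `k` far from both `i` and `j`. -/
lemma le_three_mul_of_swap (hn : 15 ≤ n) {N : Equiv.Perm (Fin n) → ℝ} {c : ℝ}
    (hmul : ∀ g h, N (g * h) ≤ N g + N h)
    (hfar : ∀ i j, FarApart i j → N (Equiv.swap i j) ≤ c) (i j : Fin n) (hij : i ≠ j) :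
    N (Equiv.swap i j) ≤ 3 * c := by
  obtain ⟨k, hik, hjk⟩ := exists_farApart hn i j
  have hfar' : ∀ a b, FarApart a b ∨ FarApart b a → N (Equiv.swap a b) ≤ c := by
    rintro a b (h | h)
    · exact hfar a b h
    · rw [Equiv.swap_comm]; exact hfar b a h
  have hki : k ≠ i := by
    rintro rfl
    simp only [FarApart] at hik
    omega
  have h := Equiv.swap_mul_swap_mul_swap (x := i) (y := k) (z := j) hki.symm hij
  have e1 := hmul (Equiv.swap k j * Equiv.swap i k) (Equiv.swap k j)
  have e2 := hmul (Equiv.swap k j) (Equiv.swap i k)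
  rw [h, Equiv.swap_comm j i] at e1
  have := hfar' k j hjk.symm
  have := hfar' i k hik
  linarith

/-- Translation invariance of the `L²`-norm makes `N g = ‖F(· g) - F‖` subadditive in the next
proof. -/
lemma wnorm_one_mul_right (φ : Equiv.Perm (Fin n) → ℝ) (g : Equiv.Perm (Fin n)) :
    wnorm (fun _ => 1) (fun σ => φ (σ * g)) = wnorm (fun _ => 1) φ := by
  unfold wnorm
  rw [← Equiv.sum_comp (Equiv.mulRight g) (fun σ => (1 : ℝ) * φ σ ^ 2)]
  rfl

/-- A Poincaré inequality on the symmetric group, for transpositions of far apart positions. -/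
lemma sum_sq_sub_le_of_farApart (hn : 15 ≤ n) (F : Equiv.Perm (Fin n) → ℝ) {M : ℝ}
    (hM : ∀ i j : Fin n, FarApart i j → ∑ σ, (F (σ * Equiv.swap i j) - F σ) ^ 2 ≤ M)
    (g : Equiv.Perm (Fin n)) :
    ∑ σ, (F (σ * g) - F σ) ^ 2 ≤ 9 * n ^ 2 * M := by
  set N : Equiv.Perm (Fin n) → ℝ := fun g => wnorm (fun _ => 1) fun σ => F (σ * g) - F σ with hN
  have hsq : ∀ g, N g ^ 2 = ∑ σ, (F (σ * g) - F σ) ^ 2 := fun g => by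
    rw [hN]; dsimp only; rw [wnorm_sq (fun _ => zero_le_one)]; simp
  have h1 : N 1 ≤ 0 := by simp [hN, wnorm]
  have hmul : ∀ g h, N (g * h) ≤ N g + N h := by
    intro g h
    have e : (fun σ => F (σ * (g * h)) - F σ)
        = (fun σ => F (σ * g) - F σ) + fun σ => F (σ * g * h) - F (σ * g) := by
      ext σ; simp [mul_assoc]
    have := wnorm_add_le (p := fun _ => 1) (fun _ => zero_le_one) (fun σ => F (σ * g) - F σ)
      fun σ => F (σ * g * h) - F (σ * g)
    rw [← e, wnorm_one_mul_right (fun σ => F (σ * h) - F σ)] at this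
    exact this
  have h3 := le_card_support_mul h1 hmul (le_three_mul_of_swap hn (c := √M) hmul fun i j hij => by
    refine Real.le_sqrt_of_sq_le ?_
    rw [hsq]
    exact hM i j hij) g
  have hM0 : 0 ≤ M := (Finset.sum_nonneg fun σ _ => sq_nonneg _).trans
    (hM ⟨0, by omega⟩ ⟨5, by omega⟩ (by simp only [FarApart]; omega))
  have hcard : (g.support.card : ℝ) ≤ n := by
    exact_mod_cast (Finset.card_le_univ _).trans (Fintype.card_fin n).le
  have h4 : N g ≤ n * (3 * √M) := h3.trans (by gcongr)
  calc ∑ σ, (F (σ * g) - F σ) ^ 2 = N g ^ 2 := (hsq g).symm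
    _ ≤ (n * (3 * √M)) ^ 2 := pow_le_pow_left₀ (wnorm_nonneg _ _) h4 2
    _ = 9 * n ^ 2 * M := by rw [mul_pow, mul_pow, Real.sq_sqrt hM0]; ring

/-- The orderings of the nodes are equidistributed over the tours. -/
lemma exists_sum_traversed {T : Equiv.Perm (Fin n) → Tour n} (hT : ∀ σ, Traverses σ (T σ)) :
    ∃ m : ℝ, 0 < m ∧ ∀ φ : Tour n → ℝ, ∑ σ, φ (T σ) = m * ∑ x, φ x := by
  classical
  have hcard : ∀ x, (Finset.univ.filter fun σ => T σ = x).card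
      = (Finset.univ.filter fun σ => T σ = T 1).card := by
    have key : ∀ x y, (Finset.univ.filter fun σ => T σ = x).card
        ≤ (Finset.univ.filter fun σ => T σ = y).card := by
      intro x y
      obtain ⟨g, rfl⟩ := exists_relabel_eq x y
      refine Finset.card_le_card_of_injOn (g * ·) (fun σ hσ => ?_) (mul_right_injective g).injOn
      simp only [Finset.coe_filter, Finset.mem_univ, true_and, Set.mem_ofPred_eq] at hσ ⊢
      rw [← hσ]
      exact (hT _).unique ((hT σ).relabel g)
    exact fun x => le_antisymm (key _ _) (key _ _)
  refine ⟨(Finset.univ.filter fun σ => T σ = T 1).card, ?_, fun φ => ?_⟩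
  · exact_mod_cast Finset.card_pos.2 ⟨1, by simp⟩
  · rw [← Finset.sum_fiberwise (s := Finset.univ) (g := T), Finset.mul_sum]
    refine Finset.sum_congr rfl fun x _ => ?_
    rw [← hcard x, ← nsmul_eq_mul, ← Finset.sum_const]
    refine Finset.sum_congr rfl fun σ hσ => ?_
    rw [(Finset.mem_filter.1 hσ).2]

lemma sum_sum_sq_sub {ι : Type*} [Fintype ι] (F : ι → ℝ) {c : ℝ}
    (hc : Fintype.card ι * c = ∑ i, F i) :
    ∑ i, ∑ j, (F j - F i) ^ 2 = 2 * Fintype.card ι * ∑ i, (F i - c) ^ 2 := by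
  have e : ∀ i j, (F j - F i) ^ 2
      = (F j - c) ^ 2 + (F i - c) ^ 2 - 2 * ((F i - c) * (F j - c)) := fun i j => by ring
  have h0 : ∑ i, (F i - c) = 0 := by
    rw [Finset.sum_sub_distrib, Finset.sum_const, Finset.card_univ, nsmul_eq_mul, hc, sub_self]
  simp only [e, Finset.sum_sub_distrib, Finset.sum_add_distrib, ← Finset.mul_sum, h0,
    Finset.sum_const, Finset.card_univ, nsmul_eq_mul, mul_zero]
  ring

/-- A Poincaré inequality for the square of a chain that makes every 2-opt move. -/
lemma poincare_twoOpt (x₀ : Tour n) (hn : 15 ≤ n) {p : Tour n → ℝ}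
    {P : Matrix (Tour n) (Tour n) ℝ} (h : Reversible p P) {A b : ℝ} (hb : 0 < b)
    (hA : ∀ x, p x ≤ A)
    (hstep : ∀ x, ∀ z ∈ twoOpt x, ∀ y ∈ twoOpt z, b ≤ p x * (P x z * P z y))
    (f : Tour n → ℝ) :
    b / (9 * n ^ 2 * A) * ∑ x, p x * centered p f x ^ 2
      ≤ (1 / 2) * ∑ x, ∑ y, p x * (P * P) x y * (f x - f y) ^ 2 := by
  classical
  set E := ∑ x, ∑ y, p x * (P * P) x y * (f x - f y) ^ 2 with hE
  choose T hT using exists_tour_traversed x₀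
  obtain ⟨m, hm, hsum⟩ := exists_sum_traversed hT
  have hPP : ∀ x y, 0 ≤ p x * (P * P) x y * (f x - f y) ^ 2 := fun x y =>
    mul_nonneg (mul_nonneg (h.weight_nonneg x) (by
      rw [Matrix.mul_apply]
      exact Finset.sum_nonneg fun z _ => mul_nonneg (h.entry_nonneg _ _) (h.entry_nonneg _ _)))
      (sq_nonneg _)
  have hfar : ∀ i j : Fin n, FarApart i j →
      ∑ σ, (f (T (σ * Equiv.swap i j)) - f (T σ)) ^ 2 ≤ m * E / b := by
    intro i j hij
    rw [le_div_iff₀ hb, Finset.sum_mul, hE, ← hsum]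
    refine Finset.sum_le_sum fun σ _ => ?_
    obtain ⟨z, hz1, hz2⟩ := exists_twoOpt_twoOpt_of_swap hij (hT σ) (hT (σ * Equiv.swap i j))
    refine le_trans ?_ (Finset.single_le_sum
      (f := fun y => p (T σ) * (P * P) (T σ) y * (f (T σ) - f y) ^ 2)
      (fun y _ => hPP _ y) (Finset.mem_univ (T (σ * Equiv.swap i j))))
    have h1 : b ≤ p (T σ) * (P * P) (T σ) (T (σ * Equiv.swap i j)) := by
      refine (hstep _ z hz1 _ hz2).trans (mul_le_mul_of_nonneg_left ?_ (h.weight_nonneg _))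
      rw [Matrix.mul_apply]
      exact Finset.single_le_sum (f := fun z => P (T σ) z * P z (T (σ * Equiv.swap i j)))
        (fun z _ => mul_nonneg (h.entry_nonneg _ _) (h.entry_nonneg _ _)) (Finset.mem_univ z)
    have h2 : (f (T (σ * Equiv.swap i j)) - f (T σ)) ^ 2
        = (f (T σ) - f (T (σ * Equiv.swap i j))) ^ 2 := by ring
    rw [h2, mul_comm]
    exact mul_le_mul_of_nonneg_right h1 (sq_nonneg _)
  have hall := sum_sq_sub_le_of_farApart hn (fun σ => f (T σ)) hfar
  set K : ℝ := (Fintype.card (Equiv.Perm (Fin n)) : ℝ) with hK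
  have hKpos : 0 < K := by rw [hK]; exact_mod_cast Fintype.card_pos
  set c : ℝ := (∑ σ, f (T σ)) / K with hc
  have hdouble : ∑ σ, ∑ τ, (f (T τ) - f (T σ)) ^ 2 ≤ K * (9 * n ^ 2 * (m * E / b)) := by
    -- Substituting `τ = σ * g` turns the double sum, which is a multiple of the variance, into
    -- translates by `g`.
    have e : ∑ σ, ∑ τ, (f (T τ) - f (T σ)) ^ 2 = ∑ g, ∑ σ, (f (T (σ * g)) - f (T σ)) ^ 2 := by
      rw [Finset.sum_comm (s := Finset.univ) (t := Finset.univ)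
        (f := fun g σ => (f (T (σ * g)) - f (T σ)) ^ 2)]
      refine Finset.sum_congr rfl fun σ _ => ?_
      exact (Equiv.sum_comp (Equiv.mulLeft σ) fun τ => (f (T τ) - f (T σ)) ^ 2).symm
    rw [e]
    calc _ ≤ ∑ _g : Equiv.Perm (Fin n), 9 * (n : ℝ) ^ 2 * (m * E / b) :=
          Finset.sum_le_sum fun g _ => hall g
      _ = _ := by rw [Finset.sum_const, Finset.card_univ, nsmul_eq_mul]
  rw [sum_sum_sq_sub (fun σ => f (T σ)) (c := c) (by rw [hc, ← hK]; field_simp)] at hdouble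
  rw [hsum fun x => (f x - c) ^ 2, ← hK] at hdouble
  have hunif : b * ∑ x, (f x - c) ^ 2 ≤ 9 * n ^ 2 * (1 / 2 * E) := by
    have e1 : K * (9 * n ^ 2 * (m * E / b)) = (2 * K * m / b) * (9 * n ^ 2 * (1 / 2 * E)) := by
      field_simp
    have e2 : 2 * K * (m * ∑ x, (f x - c) ^ 2)
        = (2 * K * m / b) * (b * ∑ x, (f x - c) ^ 2) := by field_simp
    rw [e1, e2] at hdouble
    exact le_of_mul_le_mul_left hdouble (by positivity)
  have hApos : 0 < A := by
    by_contra hcon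
    push Not at hcon
    have h2 : ∑ x, p x ≤ 0 := Finset.sum_nonpos fun x _ => (hA x).trans hcon
    rw [h.weight_sum] at h2
    linarith
  -- Change of measure from uniform to `p`: the mean under `p` is the best constant, so the uniform
  -- mean `c` can only increase the deviation.
  have hvar : ∑ x, p x * centered p f x ^ 2 ≤ A * ∑ x, (f x - c) ^ 2 := by
    refine (sum_centered_sq_le h.weight_sum f c).trans ?_
    rw [Finset.mul_sum]
    exact Finset.sum_le_sum fun x _ => mul_le_mul_of_nonneg_right (hA x) (sq_nonneg _)
  have hnpos : (0 : ℝ) < n := by exact_mod_cast (by omega : 0 < n)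
  rw [div_mul_eq_mul_div, div_le_iff₀ (by positivity)]
  calc b * ∑ x, p x * centered p f x ^ 2 ≤ b * (A * ∑ x, (f x - c) ^ 2) :=
        mul_le_mul_of_nonneg_left hvar hb.le
    _ = A * (b * ∑ x, (f x - c) ^ 2) := by ring
    _ ≤ A * (9 * n ^ 2 * (1 / 2 * E)) := mul_le_mul_of_nonneg_left hunif hApos.le
    _ = _ := by ring

end Poincare

/-! ### Simulated annealing at a fixed temperature -/

section Gibbs

variable {n : ℕ}

/-- The partition function. -/
noncomputable def partition (β : ℝ) (w : Edge n → ℝ) : ℝ :=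
  ∑ x : Tour n, Real.exp (-β * tourLength w x)

/-- The Gibbs distribution, which is stationary for simulated annealing. -/
noncomputable def gibbs (β : ℝ) (w : Edge n → ℝ) (x : Tour n) : ℝ :=
  Real.exp (-β * tourLength w x) / partition β w

lemma partition_pos (x₀ : Tour n) (β : ℝ) (w : Edge n → ℝ) : 0 < partition β w :=
  Finset.sum_pos (fun _ _ => Real.exp_pos _) ⟨x₀, Finset.mem_univ _⟩

lemma tourLength_nonneg {w : Edge n → ℝ} (hw : ∀ e, 0 ≤ w e) (x : Tour n) :
    0 ≤ tourLength w x := Finset.sum_nonneg fun e _ => hw e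

lemma tourLength_le {w : Edge n → ℝ} (hw : ∀ e, w e ≤ 1) (x : Tour n) :
    tourLength w x ≤ n := by
  calc tourLength w x ≤ ∑ _e ∈ x.1, (1 : ℝ) := Finset.sum_le_sum fun e _ => hw e
    _ = n := by rw [Finset.sum_const, card_tour, nsmul_eq_mul, mul_one]

lemma moveProb_nonneg (β : ℝ) (w : Edge n → ℝ) (x y : Tour n) : 0 ≤ moveProb β w x y :=
  mul_nonneg (by positivity) (le_min zero_le_one (Real.exp_pos _).le)

lemma sum_moveProb_le_one (β : ℝ) (w : Edge n → ℝ) (x : Tour n) :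
    ∑ y ∈ twoOpt x, moveProb β w x y ≤ 1 := by
  calc ∑ y ∈ twoOpt x, moveProb β w x y ≤ ∑ _y ∈ twoOpt x, 1 / ((twoOpt x).card : ℝ) :=
        Finset.sum_le_sum fun y _ => mul_le_of_le_one_right (by positivity) (min_le_left _ _)
    _ = (twoOpt x).card * (1 / ((twoOpt x).card : ℝ)) := by rw [Finset.sum_const, nsmul_eq_mul]
    _ ≤ 1 := by rw [mul_one_div]; exact div_self_le_one _

lemma transition_of_mem {β : ℝ} {w : Edge n → ℝ} {x y : Tour n} (h : y ∈ twoOpt x) :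
    transition β w x y = moveProb β w x y := by
  simp [transition, h]

lemma transition_self (β : ℝ) (w : Edge n → ℝ) (x : Tour n) :
    transition β w x x = 1 - ∑ z ∈ twoOpt x, moveProb β w x z := by
  simp [transition, not_mem_twoOpt_self]

lemma transition_of_notMem {β : ℝ} {w : Edge n → ℝ} {x y : Tour n} (h : y ∉ twoOpt x)
    (hxy : y ≠ x) : transition β w x y = 0 := by
  simp [transition, h, hxy]

lemma transition_nonneg (β : ℝ) (w : Edge n → ℝ) (x y : Tour n) : 0 ≤ transition β w x y := by
  by_cases h : y ∈ twoOpt x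
  · rw [transition_of_mem h]; exact moveProb_nonneg _ _ _ _
  · by_cases hxy : y = x
    · subst hxy
      rw [transition_self]
      linarith [sum_moveProb_le_one β w y]
    · rw [transition_of_notMem h hxy]

/-- A sum over all tours splits into the tour itself, its neighbors, and the rest. -/
lemma sum_eq_of_support (x : Tour n) {φ : Tour n → ℝ}
    (h : ∀ y, y ∉ twoOpt x → y ≠ x → φ y = 0) : ∑ y, φ y = φ x + ∑ y ∈ twoOpt x, φ y := by
  classical
  rw [← Finset.sum_insert (not_mem_twoOpt_self x)]
  refine (Finset.sum_subset (Finset.subset_univ _) fun y _ hy => ?_).symm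
  rw [Finset.mem_insert, not_or] at hy
  exact h y hy.2 hy.1

lemma transition_row_sum (β : ℝ) (w : Edge n → ℝ) (x : Tour n) :
    ∑ y, transition β w x y = 1 := by
  rw [sum_eq_of_support x fun y h hxy => transition_of_notMem h hxy, transition_self,
    Finset.sum_congr rfl fun y hy => transition_of_mem hy]
  ring

/-- Symmetry of the right side in `a` and `b` is the detailed balance of the Metropolis rule. -/
lemma exp_mul_min_one (a b : ℝ) :
    Real.exp a * min 1 (Real.exp (b - a)) = min (Real.exp a) (Real.exp b) := by
  rw [mul_min_of_nonneg _ _ (Real.exp_pos a).le, mul_one, ← Real.exp_add]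
  congr 2
  ring

lemma gibbs_reversible (x₀ : Tour n) (β : ℝ) (w : Edge n → ℝ) :
    Reversible (gibbs β w) (transition β w) where
  weight_nonneg x := div_nonneg (Real.exp_pos _).le (partition_pos x₀ β w).le
  weight_sum := by
    simp only [gibbs]
    rw [← Finset.sum_div]
    exact div_self (partition_pos x₀ β w).ne'
  entry_nonneg := transition_nonneg β w
  row_sum := transition_row_sum β w
  balance x y := by
    by_cases h : y ∈ twoOpt x
    · rw [transition_of_mem h, transition_of_mem (mem_twoOpt_comm.1 h)]
      have key : ∀ x y : Tour n, gibbs β w x * moveProb β w x y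
          = 1 / partition β w * (1 / ((twoOpt x).card : ℝ))
            * min (Real.exp (-β * tourLength w x)) (Real.exp (-β * tourLength w y)) := by
        intro x y
        rw [← exp_mul_min_one, gibbs, moveProb]
        rw [show -β * (tourLength w y - tourLength w x)
          = -β * tourLength w y - -β * tourLength w x by ring]
        ring
      rw [key, key, min_comm, card_twoOpt_eq x y]
    · by_cases hxy : y = x
      · rw [hxy]
      · rw [transition_of_notMem h hxy, transition_of_notMem (fun h' => h (mem_twoOpt_comm.1 h'))
          (Ne.symm hxy)]
        simp

/-- The contraction factor of the chain in epoch `k`. -/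
noncomputable def rate (n k : ℕ) : ℝ := 1 - 1 / (18 * n ^ 2 * (1024 * n ^ 2) ^ 2 * k ^ 2)

lemma rate_nonneg {n k : ℕ} (hn : 1 ≤ n) (hk : 1 ≤ k) : 0 ≤ rate n k := by
  have hn' : (1 : ℝ) ≤ n := by exact_mod_cast hn
  have hk' : (1 : ℝ) ≤ k := by exact_mod_cast hk
  have h1 := one_le_pow₀ (n := 2) hn'
  have h2 : (1 : ℝ) ≤ (1024 * n ^ 2) ^ 2 := one_le_pow₀ (by linarith)
  have h3 := one_le_pow₀ (n := 2) hk'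
  have h4 : (1 : ℝ) ≤ 18 * n ^ 2 * (1024 * n ^ 2) ^ 2 * k ^ 2 :=
    one_le_mul_of_one_le_of_one_le
      (one_le_mul_of_one_le_of_one_le (by linarith) h2) h3
  rw [rate, sub_nonneg, div_le_one (by linarith)]
  exact h4

lemma rate_le_one (n k : ℕ) : rate n k ≤ 1 := by
  rw [rate, sub_le_self_iff]
  positivity

lemma le_min_one_exp {β c : ℝ} (hβ : 0 ≤ β) {s t : ℝ} (hc : 0 ≤ c) (h : t - s ≤ c) :
    Real.exp (-(β * c)) ≤ min 1 (Real.exp (-β * (t - s))) := by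
  refine le_min (Real.exp_le_one_iff.2 (by nlinarith)) (Real.exp_le_exp.2 ?_)
  nlinarith

/-- In the Poincaré constant the partition function cancels between the upper bound for the Gibbs
weights and the lower bound for two-step flows. What remains is `9 * n ^ 2` from the group, two
proposal probabilities, and `k ^ 2` from the Boltzmann factors. -/
lemma gibbs_contracts (x₀ : Tour n) (hn : 15 ≤ n) {β : ℝ} (hβ : 0 ≤ β) {w : Edge n → ℝ}
    (hw0 : ∀ e, 0 ≤ w e) (hw1 : ∀ e, w e ≤ 1) {k : ℕ} (hk : 1 ≤ k)
    (hβk : Real.exp (β * n) ≤ k) : Contracts (gibbs β w) (transition β w) (rate n k) := by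
  have hrev := gibbs_reversible x₀ β w
  have hZ := partition_pos x₀ β w
  have hk0 : (0 : ℝ) < k := by exact_mod_cast hk
  have hn0 : (0 : ℝ) < n := by exact_mod_cast (by omega : 0 < n)
  have hexp : 1 / (k : ℝ) ≤ Real.exp (-(β * n)) := by
    rw [Real.exp_neg, one_div]
    exact inv_anti₀ (Real.exp_pos _) hβk
  have hA : ∀ x, gibbs β w x ≤ 1 / partition β w := fun x => by
    rw [gibbs]
    gcongr
    refine Real.exp_le_one_iff.2 ?_
    nlinarith [tourLength_nonneg hw0 x]
  have hstep : ∀ x, ∀ z ∈ twoOpt x, ∀ y ∈ twoOpt z,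
      1 / partition β w * (1 / ((1024 * n ^ 2) ^ 2 * k ^ 2))
        ≤ gibbs β w x * (transition β w x z * transition β w z y) := by
    intro x z hz y hy
    have hd : ∀ v : Tour n, ∀ u ∈ twoOpt v, (0 : ℝ) < (twoOpt v).card := fun v u hu => by
      exact_mod_cast Finset.card_pos.2 ⟨u, hu⟩
    have hd' : ∀ v : Tour n, ((twoOpt v).card : ℝ) ≤ 1024 * (n : ℝ) ^ 2 := fun v => by
      exact_mod_cast card_twoOpt_le v
    rw [transition_of_mem hz, transition_of_mem hy, moveProb, moveProb, gibbs]
    -- The Gibbs weight and the first acceptance combine into a minimum of two Boltzmann factors, so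
    -- together they cost a single factor `1 / k`; the second acceptance costs the other.
    have m1 : Real.exp (-(β * n)) ≤ Real.exp (-β * tourLength w x)
        * min 1 (Real.exp (-β * (tourLength w z - tourLength w x))) := by
      rw [show -β * (tourLength w z - tourLength w x)
          = -β * tourLength w z - -β * tourLength w x by ring, exp_mul_min_one]
      refine le_min (Real.exp_le_exp.2 ?_) (Real.exp_le_exp.2 ?_)
      · nlinarith [tourLength_le hw1 x]
      · nlinarith [tourLength_le hw1 z]
    have m2 : Real.exp (-(β * n)) ≤ min 1 (Real.exp (-β * (tourLength w y - tourLength w z))) :=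
      le_min_one_exp hβ hn0.le (by linarith [tourLength_le hw1 y, tourLength_nonneg hw0 z])
    calc 1 / partition β w * (1 / ((1024 * (n : ℝ) ^ 2) ^ 2 * k ^ 2))
        = 1 / partition β w * (1 / (1024 * (n : ℝ) ^ 2)) * (1 / (1024 * (n : ℝ) ^ 2))
            * ((1 / k) * (1 / k)) := by field_simp
      _ ≤ 1 / partition β w * (1 / ((twoOpt x).card : ℝ)) * (1 / ((twoOpt z).card : ℝ))
            * ((Real.exp (-β * tourLength w x)
              * min 1 (Real.exp (-β * (tourLength w z - tourLength w x))))
              * min 1 (Real.exp (-β * (tourLength w y - tourLength w z)))) := by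
          gcongr
          · exact hd x z hz
          · exact hd' x
          · exact hd z y hy
          · exact hd' z
          · exact hexp.trans m1
          · exact hexp.trans m2
      _ = _ := by ring
  refine hrev.wnorm_mulVec_le (γ := 1 / (9 * n ^ 2 * (1024 * n ^ 2) ^ 2 * k ^ 2))
    (rate_nonneg (by omega) hk) ?_ fun f => ?_
  -- The rate is `1 - γ / 2`, whose square is at least `1 - γ`.
  · have : rate n k = 1 - (1 / (9 * n ^ 2 * (1024 * n ^ 2) ^ 2 * k ^ 2)) / 2 := by
      rw [rate]
      field_simp
      ring
    rw [this]
    nlinarith [sq_nonneg (1 / (9 * (n : ℝ) ^ 2 * (1024 * n ^ 2) ^ 2 * k ^ 2))]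
  · have := poincare_twoOpt x₀ hn hrev (by positivity) hA hstep f
    convert this using 2
    field_simp

lemma card_tours_le (x₀ : Tour n) : Fintype.card (Tour n) ≤ n ^ n := by
  choose T hT using exists_tour_traversed x₀
  have hsurj : Function.Surjective T := by
    intro x
    obtain ⟨σ, hσ⟩ := exists_traverses x
    exact ⟨σ, (hT σ).unique hσ⟩
  calc Fintype.card (Tour n) ≤ Fintype.card (Equiv.Perm (Fin n)) :=
        Fintype.card_le_of_surjective T hsurj
    _ = n.factorial := by rw [Fintype.card_perm, Fintype.card_fin]
    _ ≤ n ^ n := Nat.factorial_le_pow n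

/-- The Boltzmann factor is at least `exp (-β n) ≥ 1 / k`, and there are at most `n ^ n` tours. -/
lemma le_gibbs (x₀ : Tour n) {β : ℝ} (hβ : 0 ≤ β) {w : Edge n → ℝ}
    (hw0 : ∀ e, 0 ≤ w e) (hw1 : ∀ e, w e ≤ 1) {k : ℕ} (hk : 1 ≤ k)
    (hβk : Real.exp (β * n) ≤ k) (x : Tour n) : 1 / ((k : ℝ) * n ^ n) ≤ gibbs β w x := by
  have hk0 : (0 : ℝ) < k := by exact_mod_cast hk
  have hZ : partition β w ≤ n ^ n := by
    calc partition β w ≤ ∑ _x : Tour n, (1 : ℝ) := by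
          refine Finset.sum_le_sum fun x _ => Real.exp_le_one_iff.2 ?_
          nlinarith [tourLength_nonneg hw0 x]
      _ = Fintype.card (Tour n) := by simp
      _ ≤ n ^ n := by exact_mod_cast card_tours_le x₀
  have hexp : 1 / (k : ℝ) ≤ Real.exp (-β * tourLength w x) := by
    calc 1 / (k : ℝ) ≤ Real.exp (-(β * n)) := by
          rw [Real.exp_neg, one_div]
          exact inv_anti₀ (Real.exp_pos _) hβk
      _ ≤ _ := Real.exp_le_exp.2 (by nlinarith [tourLength_le hw1 x])
  rw [← div_div, gibbs]
  exact div_le_div₀ (Real.exp_pos _).le hexp (partition_pos x₀ β w) hZ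

end Gibbs

/-! ### Lipschitz dependence of transitions and Gibbs weights on the edge weights -/

section Closeness

variable {n : ℕ}

lemma abs_min_one_exp_sub_le (a b : ℝ) :
    |min 1 (Real.exp a) - min 1 (Real.exp b)| ≤ |a - b| := by
  have key : ∀ a b : ℝ, a ≤ b → |min 1 (Real.exp b) - min 1 (Real.exp a)| ≤ b - a := by
    intro a b hab
    have h0 : min 1 (Real.exp a) ≤ min 1 (Real.exp b) :=
      min_le_min_left _ (Real.exp_le_exp.2 hab)
    rw [abs_of_nonneg (sub_nonneg.2 h0)]
    have h1 : min 1 (Real.exp b) * (1 - (b - a)) ≤ min 1 (Real.exp a) := by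
      have h2 : 1 - (b - a) ≤ Real.exp (a - b) := by linarith [Real.add_one_le_exp (a - b)]
      have h3 : Real.exp (a - b) ≤ 1 := Real.exp_le_one_iff.2 (by linarith)
      have h4 : 0 ≤ min 1 (Real.exp b) := le_min zero_le_one (Real.exp_pos _).le
      refine (mul_le_mul_of_nonneg_left h2 h4).trans (le_min ?_ ?_)
      · exact mul_le_one₀ (min_le_left _ _) (Real.exp_pos _).le h3
      · calc min 1 (Real.exp b) * Real.exp (a - b) ≤ Real.exp b * Real.exp (a - b) :=
              mul_le_mul_of_nonneg_right (min_le_right _ _) (Real.exp_pos _).le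
          _ = Real.exp a := by rw [← Real.exp_add]; congr 1; ring
    nlinarith [min_le_left 1 (Real.exp b)]
  rcases le_total a b with h | h
  · rw [abs_sub_comm, abs_sub_comm a b, abs_of_nonneg (sub_nonneg.2 h)]
    exact key a b h
  · rw [abs_of_nonneg (sub_nonneg.2 h)]
    exact key b a h

variable {β δ : ℝ} {w w' : Edge n → ℝ}

/-- Length differences move by at most `δ`, so acceptance probabilities move by at most `β * δ`.
This is counted once off the diagonal and once on it, since rejections compensate. -/
lemma sum_abs_transition_sub_le (hβ : 0 ≤ β) (hδ : 0 ≤ δ)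
    (h1 : ∀ x, tourLength w x ≤ tourLength w' x) (h2 : ∀ x, tourLength w' x ≤ tourLength w x + δ)
    (x : Tour n) : ∑ y, |transition β w' x y - transition β w x y| ≤ 2 * (β * δ) := by
  have hmove : ∑ y ∈ twoOpt x, |moveProb β w' x y - moveProb β w x y| ≤ β * δ := by
    calc ∑ y ∈ twoOpt x, |moveProb β w' x y - moveProb β w x y|
        ≤ ∑ _y ∈ twoOpt x, 1 / ((twoOpt x).card : ℝ) * (β * δ) := by
          refine Finset.sum_le_sum fun y _ => ?_
          rw [moveProb, moveProb, ← mul_sub, abs_mul, abs_of_nonneg (by positivity)]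
          refine mul_le_mul_of_nonneg_left ((abs_min_one_exp_sub_le _ _).trans ?_) (by positivity)
          rw [← mul_sub, abs_mul, abs_neg, abs_of_nonneg hβ]
          refine mul_le_mul_of_nonneg_left (abs_le.2 ⟨?_, ?_⟩) hβ <;>
            linarith [h1 x, h1 y, h2 x, h2 y]
      _ = (twoOpt x).card * (1 / ((twoOpt x).card : ℝ)) * (β * δ) := by
          rw [Finset.sum_const, nsmul_eq_mul, mul_assoc]
      _ ≤ 1 * (β * δ) := by
          refine mul_le_mul_of_nonneg_right ?_ (mul_nonneg hβ hδ)
          rw [mul_one_div]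
          exact div_self_le_one _
      _ = β * δ := one_mul _
  rw [sum_eq_of_support x fun y h hxy => by
    rw [transition_of_notMem h hxy, transition_of_notMem h hxy, sub_zero, abs_zero]]
  have hoff : ∑ y ∈ twoOpt x, |transition β w' x y - transition β w x y| ≤ β * δ := by
    rw [Finset.sum_congr rfl fun y hy => by rw [transition_of_mem hy, transition_of_mem hy]]
    exact hmove
  have hdiag : |transition β w' x x - transition β w x x| ≤ β * δ := by
    rw [transition_self, transition_self, sub_sub_sub_cancel_left, ← Finset.sum_sub_distrib]
    refine (Finset.abs_sum_le_sum_abs _ _).trans (le_trans (le_of_eq ?_) hmove)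
    exact Finset.sum_congr rfl fun y _ => abs_sub_comm _ _
  linarith

/-- Boltzmann factors decrease, by a relative amount of at most `β * δ`. The change of the
numerators and that of the partition function each contribute `(Z - Z') / Z` in total. -/
lemma sum_abs_gibbs_sub_le (x₀ : Tour n) (hβ : 0 ≤ β)
    (h1 : ∀ x, tourLength w x ≤ tourLength w' x) (h2 : ∀ x, tourLength w' x ≤ tourLength w x + δ) :
    ∑ x, |gibbs β w' x - gibbs β w x| ≤ 2 * (β * δ) := by
  have hZ := partition_pos x₀ β w
  have hZ' := partition_pos x₀ β w'
  have hle : ∀ x, Real.exp (-β * tourLength w' x) ≤ Real.exp (-β * tourLength w x) := fun x =>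
    Real.exp_le_exp.2 (by nlinarith [h1 x])
  have hge : ∀ x, Real.exp (-β * tourLength w x) * (1 - β * δ)
      ≤ Real.exp (-β * tourLength w' x) := fun x => by
    have e1 : 1 - β * δ ≤ Real.exp (-(β * δ)) := by linarith [Real.add_one_le_exp (-(β * δ))]
    calc _ ≤ Real.exp (-β * tourLength w x) * Real.exp (-(β * δ)) :=
          mul_le_mul_of_nonneg_left e1 (Real.exp_pos _).le
      _ = Real.exp (-β * tourLength w x + -(β * δ)) := (Real.exp_add _ _).symm
      _ ≤ _ := Real.exp_le_exp.2 (by nlinarith [h2 x])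
  have hZle : partition β w' ≤ partition β w := Finset.sum_le_sum fun x _ => hle x
  have hZge : partition β w * (1 - β * δ) ≤ partition β w' := by
    rw [partition, Finset.sum_mul]
    exact Finset.sum_le_sum fun x _ => hge x
  have hterm : ∀ x, |gibbs β w' x - gibbs β w x|
      ≤ gibbs β w' x * ((partition β w - partition β w') / partition β w)
        + (Real.exp (-β * tourLength w x) - Real.exp (-β * tourLength w' x)) / partition β w := by
    intro x
    have e1 : gibbs β w' x - gibbs β w x
        = gibbs β w' x * ((partition β w - partition β w') / partition β w)
        - (Real.exp (-β * tourLength w x) - Real.exp (-β * tourLength w' x)) / partition β w := by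
      rw [gibbs, gibbs]
      field_simp
      ring
    have e2 : 0 ≤ gibbs β w' x * ((partition β w - partition β w') / partition β w) :=
      mul_nonneg (div_nonneg (Real.exp_pos _).le hZ'.le)
        (div_nonneg (sub_nonneg.2 hZle) hZ.le)
    have e3 : 0 ≤ (Real.exp (-β * tourLength w x) - Real.exp (-β * tourLength w' x))
        / partition β w := div_nonneg (sub_nonneg.2 (hle x)) hZ.le
    rw [e1, abs_le]
    constructor <;> linarith
  refine (Finset.sum_le_sum fun x _ => hterm x).trans ?_
  rw [Finset.sum_add_distrib, ← Finset.sum_mul, (gibbs_reversible x₀ β w').weight_sum, one_mul,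
    ← Finset.sum_div, Finset.sum_sub_distrib]
  change (partition β w - partition β w') / partition β w
    + (partition β w - partition β w') / partition β w ≤ _
  have : (partition β w - partition β w') / partition β w ≤ β * δ := by
    rw [div_le_iff₀ hZ]
    nlinarith
  linarith

end Closeness

/-! ### The law of the current tour -/

section Law

variable {n : ℕ}

lemma mean_vecMul {X : Type*} [Fintype X] (μ : X → ℝ) (P : Matrix X X ℝ) (f : X → ℝ) :
    mean (μ ᵥ* P) f = mean μ (P *ᵥ f) :=
  (Matrix.dotProduct_mulVec μ P f).symm

lemma mean_law_succ (a : ℝ) (L : ℕ → ℕ) (x₀ : Tour n) (w : Edge n → ℝ) (k : ℕ) (f : Tour n → ℝ) :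
    mean (law a L x₀ w (k + 1)) f
      = mean (law a L x₀ w k) (transition (invTemp a (k + 1 : ℕ)) w ^ L (k + 1) *ᵥ f) := by
  rw [law, mean_vecMul]

lemma law_isProb (a : ℝ) (L : ℕ → ℕ) (x₀ : Tour n) (w : Edge n → ℝ) (k : ℕ) :
    (∀ x, 0 ≤ law a L x₀ w k x) ∧ ∑ x, law a L x₀ w k x = 1 := by
  classical
  induction k with
  | zero =>
    refine ⟨fun x => ?_, ?_⟩
    · simp only [law, Pi.single_apply]
      split_ifs <;> norm_num
    · simp [law]
  | succ k ih =>
    set P := transition (invTemp a (k + 1 : ℕ)) w with hP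
    have hrev : Reversible _ P := gibbs_reversible x₀ _ w
    constructor
    · intro x
      have hnn : ∀ j x y, 0 ≤ (P ^ j) x y := by
        intro j
        induction j with
        | zero =>
          intro x y
          rw [pow_zero, Matrix.one_apply]
          split_ifs <;> norm_num
        | succ j ih =>
          intro x y
          rw [pow_succ, Matrix.mul_apply]
          exact Finset.sum_nonneg fun z _ => mul_nonneg (ih _ _) (hrev.entry_nonneg _ _)
      have : law a L x₀ w (k + 1) x = ∑ y, law a L x₀ w k y * (P ^ L (k + 1)) y x := by
        rw [law, hP]
        norm_cast
      rw [this]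
      exact Finset.sum_nonneg fun y _ => mul_nonneg (ih.1 y) (hnn _ _ _)
    · have h1 := mean_law_succ a L x₀ w k fun _ => 1
      have h2 : ∀ j, (P ^ j *ᵥ fun _ => (1 : ℝ)) = fun _ => 1 := by
        intro j
        induction j with
        | zero => simp
        | succ j ih => rw [Reversible.pow_mulVec_succ, ih, mulVec_const hrev.row_sum]
      rw [← hP, h2] at h1
      simpa [mean, ih.2] using h1

/-- The epochs `1, …, t` are long enough for the chain to forget its past up to an error `ξ`. -/
structure LongEpochs (n : ℕ) (a : ℝ) (L : ℕ → ℕ) (t : ℕ) (ξ : ℝ) : Prop where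
  fifteen_le : 15 ≤ n
  le_a : (n : ℝ) ≤ a
  pos : 0 < ξ
  le_one : ξ ≤ 1
  mixing : ∀ k ∈ Finset.Icc 1 t,
    ((L k : ℝ) + 1) * rate n k ^ (L k - 1) / (1 / ((k : ℝ) * n ^ n)) ≤ ξ

namespace LongEpochs

variable {a ξ : ℝ} {L : ℕ → ℕ} {t : ℕ}

lemma a_pos (h : LongEpochs n a L t ξ) : 0 < a := by
  have : (0 : ℝ) < n := by exact_mod_cast (by have := h.fifteen_le; omega : 0 < n)
  linarith [h.le_a]

lemma invTemp_nonneg (h : LongEpochs n a L t ξ) (k : ℕ) : 0 ≤ invTemp a k :=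
  div_nonneg (Real.log_natCast_nonneg k) h.a_pos.le

lemma invTemp_mono (h : LongEpochs n a L t ξ) {k l : ℕ} (hk : 1 ≤ k) (hkl : k ≤ l) :
    invTemp a k ≤ invTemp a l := by
  have : (0 : ℝ) < k := by exact_mod_cast hk
  exact div_le_div_of_nonneg_right (Real.log_le_log this (by exact_mod_cast hkl)) h.a_pos.le

lemma exp_invTemp_le (h : LongEpochs n a L t ξ) {k : ℕ} (hk : 1 ≤ k) :
    Real.exp (invTemp a k * n) ≤ k := by
  have hk0 : (0 : ℝ) < k := by exact_mod_cast hk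
  conv_rhs => rw [← Real.exp_log hk0]
  refine Real.exp_le_exp.2 ?_
  rw [invTemp, div_mul_eq_mul_div, div_le_iff₀ h.a_pos]
  exact mul_le_mul_of_nonneg_left h.le_a (Real.log_natCast_nonneg k)

lemma kappa_pos (h : LongEpochs n a L t ξ) {k : ℕ} (hk : 1 ≤ k) :
    (0 : ℝ) < 1 / ((k : ℝ) * n ^ n) := by
  have hk0 : (0 : ℝ) < k := by exact_mod_cast hk
  have : (0 : ℝ) < n := by exact_mod_cast (by have := h.fifteen_le; omega : 0 < n)
  positivity

lemma kappa_le_one (h : LongEpochs n a L t ξ) {k : ℕ} (hk : 1 ≤ k) :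
    1 / ((k : ℝ) * n ^ n) ≤ 1 := by
  have hk0 : (1 : ℝ) ≤ k := by exact_mod_cast hk
  have hn0 : (1 : ℝ) ≤ n := by exact_mod_cast (by have := h.fifteen_le; omega : 1 ≤ n)
  rw [div_le_one (by positivity)]
  exact one_le_mul_of_one_le_of_one_le hk0 (one_le_pow₀ hn0)

/-- At the end of an epoch the chain is close to the Gibbs distribution. -/
lemma abs_pow_sub_le (h : LongEpochs n a L t ξ) (x₀ : Tour n) {w : Edge n → ℝ}
    (hw0 : ∀ e, 0 ≤ w e) (hw1 : ∀ e, w e ≤ 1) {k : ℕ} (hk : k ∈ Finset.Icc 1 t)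
    {f : Tour n → ℝ} (hf : ∀ x, |f x| ≤ 1) (x : Tour n) :
    |(transition (invTemp a k) w ^ L k *ᵥ f) x - mean (gibbs (invTemp a k) w) f| ≤ ξ := by
  have hk1 := (Finset.mem_Icc.1 hk).1
  have hρ := rate_nonneg (n := n) (k := k) (by have := h.fifteen_le; omega) hk1
  have hκ := h.kappa_pos hk1
  refine ((gibbs_reversible x₀ _ w).abs_pow_mulVec_sub_mean_le
    (gibbs_contracts x₀ h.fifteen_le (h.invTemp_nonneg k) hw0 hw1 hk1 (h.exp_invTemp_le hk1))
    hρ hκ (le_gibbs x₀ (h.invTemp_nonneg k) hw0 hw1 hk1 (h.exp_invTemp_le hk1))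
    (L k) hf x).trans (le_trans ?_ (h.mixing k hk))
  refine div_le_div₀ (by positivity) ?_ hκ ?_
  · calc rate n k ^ L k ≤ rate n k ^ (L k - 1) :=
          pow_le_pow_of_le_one hρ (rate_le_one n k) (Nat.sub_le _ _)
      _ ≤ ((L k : ℝ) + 1) * rate n k ^ (L k - 1) :=
          le_mul_of_one_le_left (pow_nonneg hρ _) (by linarith [Nat.cast_nonneg (α := ℝ) (L k)])
  · refine Real.le_sqrt_of_sq_le ?_
    nlinarith [h.kappa_le_one hk1]

variable {w w' : Edge n → ℝ} {δ : ℝ}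

/-- At the end of an epoch the deviation from the Gibbs distribution is a Lipschitz function of the
weights, with a small constant. -/
lemma abs_deviation_sub_le (h : LongEpochs n a L t ξ) (x₀ : Tour n)
    (hw0 : ∀ e, 0 ≤ w e) (hw1 : ∀ e, w e ≤ 1) (hw0' : ∀ e, 0 ≤ w' e) (hw1' : ∀ e, w' e ≤ 1)
    (hδ : 0 ≤ δ) (h1 : ∀ x, tourLength w x ≤ tourLength w' x)
    (h2 : ∀ x, tourLength w' x ≤ tourLength w x + δ) {k : ℕ} (hk : k ∈ Finset.Icc 1 t)
    {f : Tour n → ℝ} (hf : ∀ x, |f x| ≤ 1) (x : Tour n) :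
    |((transition (invTemp a k) w' ^ L k *ᵥ f) x - mean (gibbs (invTemp a k) w') f)
      - ((transition (invTemp a k) w ^ L k *ᵥ f) x - mean (gibbs (invTemp a k) w) f)|
      ≤ 2 * (invTemp a k * δ) * ξ := by
  have hk1 := (Finset.mem_Icc.1 hk).1
  have hβ := h.invTemp_nonneg k
  have hρ := rate_nonneg (n := n) (k := k) (by have := h.fifteen_le; omega) hk1
  refine ((gibbs_reversible x₀ _ w).abs_deviation_sub_deviation_le (gibbs_reversible x₀ _ w')
    (gibbs_contracts x₀ h.fifteen_le hβ hw0 hw1 hk1 (h.exp_invTemp_le hk1))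
    (gibbs_contracts x₀ h.fifteen_le hβ hw0' hw1' hk1 (h.exp_invTemp_le hk1))
    hρ (rate_le_one n k) (h.kappa_pos hk1) (h.kappa_le_one hk1)
    (le_gibbs x₀ hβ hw0 hw1 hk1 (h.exp_invTemp_le hk1))
    (le_gibbs x₀ hβ hw0' hw1' hk1 (h.exp_invTemp_le hk1)) (η := 2 * (invTemp a k * δ))
    (by positivity) (sum_abs_transition_sub_le hβ hδ h1 h2)
    (sum_abs_gibbs_sub_le x₀ hβ h1 h2) (L k) hf x).trans ?_
  exact mul_le_mul_of_nonneg_left (h.mixing k hk) (by positivity)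

/-- The law of the current tour is a Lipschitz function of the weights. -/
lemma abs_mean_law_sub_le (h : LongEpochs n a L t ξ) (x₀ : Tour n)
    (hw0 : ∀ e, 0 ≤ w e) (hw1 : ∀ e, w e ≤ 1) (hw0' : ∀ e, 0 ≤ w' e) (hw1' : ∀ e, w' e ≤ 1)
    (hδ : 0 ≤ δ) (h1 : ∀ x, tourLength w x ≤ tourLength w' x)
    (h2 : ∀ x, tourLength w' x ≤ tourLength w x + δ) {k : ℕ} (hk : k ≤ t)
    {f : Tour n → ℝ} (hf : ∀ x, |f x| ≤ 1) :
    |mean (law a L x₀ w' k) f - mean (law a L x₀ w k) f| ≤ 4 * k * (invTemp a t * δ) := by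
  induction k generalizing f with
  -- The starting tour does not depend on the weights.
  | zero => simp [law]
  | succ k ih =>
    have hmem : k + 1 ∈ Finset.Icc 1 t := Finset.mem_Icc.2 ⟨by omega, hk⟩
    have hβ := h.invTemp_nonneg (k + 1)
    have hβt : invTemp a (k + 1 : ℕ) * δ ≤ invTemp a t * δ :=
      mul_le_mul_of_nonneg_right (h.invTemp_mono (by omega) hk) hδ
    rw [mean_law_succ, mean_law_succ]
    set P := transition (invTemp a (k + 1 : ℕ)) w with hP
    set P' := transition (invTemp a (k + 1 : ℕ)) w' with hP'
    -- Separate the change of the earlier law, tested against a function still bounded by `1`, from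
    -- the change of the current epoch.
    have e : mean (law a L x₀ w' k) (P' ^ L (k + 1) *ᵥ f) - mean (law a L x₀ w k)
          (P ^ L (k + 1) *ᵥ f)
        = (mean (law a L x₀ w' k) (P' ^ L (k + 1) *ᵥ f) - mean (law a L x₀ w k)
            (P' ^ L (k + 1) *ᵥ f))
          + mean (law a L x₀ w k) (P' ^ L (k + 1) *ᵥ f - P ^ L (k + 1) *ᵥ f) := by
      rw [mean_sub]; ring
    have i1 := ih (by omega) (f := P' ^ L (k + 1) *ᵥ f)
      ((gibbs_reversible x₀ _ w').abs_pow_mulVec_le _ hf)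
    have i2 : |mean (law a L x₀ w k) (P' ^ L (k + 1) *ᵥ f - P ^ L (k + 1) *ᵥ f)|
        ≤ 4 * (invTemp a t * δ) := by
      refine abs_mean_le (law_isProb a L x₀ w k).1 (law_isProb a L x₀ w k).2 fun x => ?_
      have j1 := h.abs_deviation_sub_le x₀ hw0 hw1 hw0' hw1' hδ h1 h2 hmem hf x
      have j2 := abs_mean_sub_mean_le (sum_abs_gibbs_sub_le x₀ hβ h1 h2) zero_le_one hf
      rw [← hP, ← hP'] at j1
      have j3 : 2 * (invTemp a (k + 1 : ℕ) * δ) * ξ ≤ 2 * (invTemp a (k + 1 : ℕ) * δ) :=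
        mul_le_of_le_one_right (by positivity) h.le_one
      rw [abs_le] at j1 j2 ⊢
      rw [Pi.sub_apply]
      constructor <;> linarith [j1.1, j1.2, j2.1, j2.2]
    rw [e]
    refine (abs_add_le _ _).trans ((add_le_add i1 i2).trans (le_of_eq ?_))
    push_cast
    ring

/-- The probability that the final tour satisfies an event depends on the weights almost as
under the Gibbs distribution. -/
lemma abs_law_deviation_le (h : LongEpochs n a L t ξ) (ht : 1 ≤ t) (x₀ : Tour n)
    (hw0 : ∀ e, 0 ≤ w e) (hw1 : ∀ e, w e ≤ 1) (hw0' : ∀ e, 0 ≤ w' e) (hw1' : ∀ e, w' e ≤ 1)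
    (hδ : 0 ≤ δ) (h1 : ∀ x, tourLength w x ≤ tourLength w' x)
    (h2 : ∀ x, tourLength w' x ≤ tourLength w x + δ)
    {f : Tour n → ℝ} (hf : ∀ x, |f x| ≤ 1) :
    |mean (law a L x₀ w t) f - mean (gibbs (invTemp a t) w) f| ≤ ξ ∧
    |(mean (law a L x₀ w' t) f - mean (gibbs (invTemp a t) w') f)
      - (mean (law a L x₀ w t) f - mean (gibbs (invTemp a t) w) f)|
      ≤ 4 * t * (invTemp a t * δ) * ξ := by
  -- The last epoch is split off: its mixing supplies the factor `ξ`, while the earlier epochs enter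
  -- only through the cruder Lipschitz bound.
  obtain ⟨k, rfl⟩ : ∃ k, t = k + 1 := ⟨t - 1, by omega⟩
  have hmem : k + 1 ∈ Finset.Icc 1 (k + 1) := Finset.mem_Icc.2 ⟨by omega, le_rfl⟩
  rw [mean_law_succ, mean_law_succ]
  set β := invTemp a (k + 1 : ℕ) with hβ
  have hlaw := fun w => law_isProb a L x₀ w k
  set g : (Edge n → ℝ) → Tour n → ℝ := fun w x =>
    (transition β w ^ L (k + 1) *ᵥ f) x - mean (gibbs β w) f with hg
  have hmean : ∀ v : Edge n → ℝ, mean (law a L x₀ v k) (transition β v ^ L (k + 1) *ᵥ f)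
      - mean (gibbs β v) f = mean (law a L x₀ v k) (g v) := by
    intro v
    have : g v = transition β v ^ L (k + 1) *ᵥ f - fun _ => mean (gibbs β v) f := rfl
    rw [this, mean_sub, mean_const (hlaw v).2]
  have hb : ∀ x, |g w x| ≤ ξ := h.abs_pow_sub_le x₀ hw0 hw1 hmem hf
  have hb' : ∀ x, |g w' x| ≤ ξ := h.abs_pow_sub_le x₀ hw0' hw1' hmem hf
  rw [hmean, hmean]
  refine ⟨abs_mean_le (hlaw w).1 (hlaw w).2 hb, ?_⟩
  -- The function `g w'` is divided by `ξ` so that the Lipschitz bound for the earlier law, stated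
  -- for functions bounded by `1`, applies and gains `ξ`.
  have e : mean (law a L x₀ w' k) (g w') - mean (law a L x₀ w k) (g w)
      = ξ * (mean (law a L x₀ w' k) (fun x => g w' x / ξ)
          - mean (law a L x₀ w k) (fun x => g w' x / ξ))
        + mean (law a L x₀ w k) (g w' - g w) := by
    have e1 : ∀ μ : Tour n → ℝ, ξ * mean μ (fun x => g w' x / ξ) = mean μ (g w') := by
      intro μ
      rw [mean, mean, Finset.mul_sum]
      refine Finset.sum_congr rfl fun x _ => ?_
      have := h.pos.ne'
      field_simp
    rw [mul_sub, e1, e1, mean_sub]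
    ring
  have i1 := h.abs_mean_law_sub_le x₀ hw0 hw1 hw0' hw1' hδ h1 h2 (k := k) (by omega)
    (f := fun x => g w' x / ξ) (fun x => by
      rw [abs_div, abs_of_pos h.pos, div_le_one h.pos]; exact hb' x)
  have i2 : |mean (law a L x₀ w k) (g w' - g w)| ≤ 2 * (β * δ) * ξ :=
    abs_mean_le (hlaw w).1 (hlaw w).2 fun x =>
      h.abs_deviation_sub_le x₀ hw0 hw1 hw0' hw1' hδ h1 h2 hmem hf x
  have hβ0 : 0 ≤ β := h.invTemp_nonneg _
  have hpos : 0 ≤ β * δ * ξ := mul_nonneg (mul_nonneg hβ0 hδ) h.pos.le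
  rw [e]
  refine (abs_add_le _ _).trans ?_
  rw [abs_mul, abs_of_pos h.pos]
  calc _ ≤ ξ * (4 * k * (β * δ)) + 2 * (β * δ) * ξ :=
        add_le_add (mul_le_mul_of_nonneg_left i1 h.pos.le) i2
    _ ≤ _ := by push_cast; nlinarith

/-- Raising the weight of an edge by `δ` lowers the probability that the final tour uses it at most
by the factor `exp (-β δ)`. -/
lemma exp_mul_mean_law_le (h : LongEpochs n a L t ξ) (ht : 1 ≤ t) (x₀ : Tour n)
    (hξ : ξ * (8 * t + 2) ≤ (1 / ((t : ℝ) * n ^ n)) ^ 2) (hβ1 : invTemp a t ≤ 1)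
    (hw0 : ∀ e, 0 ≤ w e) (hw1 : ∀ e, w e ≤ 1) (hw0' : ∀ e, 0 ≤ w' e) (hw1' : ∀ e, w' e ≤ 1)
    (hδ : 0 ≤ δ) (hδ1 : δ ≤ 1) (S : Set (Tour n))
    (hin : ∀ x ∈ S, tourLength w' x = tourLength w x + δ)
    (hout : ∀ x ∉ S, tourLength w' x = tourLength w x) :
    Real.exp (-(invTemp a t * δ)) * mean (law a L x₀ w t) (S.indicator 1)
      ≤ mean (law a L x₀ w' t) (S.indicator 1) := by
  classical
  set β := invTemp a t with hβ
  set κ : ℝ := 1 / ((t : ℝ) * n ^ n) with hκ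
  have hκ0 : 0 < κ := h.kappa_pos ht
  have hβ0 : 0 ≤ β := h.invTemp_nonneg t
  rcases S.eq_empty_or_nonempty with rfl | ⟨y, hy⟩
  · simp [mean]
  have h1 : ∀ x, tourLength w x ≤ tourLength w' x := fun x => by
    by_cases hx : x ∈ S
    · rw [hin x hx]; linarith
    · rw [hout x hx]
  have h2 : ∀ x, tourLength w' x ≤ tourLength w x + δ := fun x => by
    by_cases hx : x ∈ S
    · rw [hin x hx]
    · rw [hout x hx]; linarith
  set f : Tour n → ℝ := S.indicator 1 with hf
  have hf1 : ∀ x, |f x| ≤ 1 := fun x => by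
    by_cases hx : x ∈ S <;> simp [hf, hx]
  have hf0 : ∀ x, 0 ≤ f x := fun x => by
    by_cases hx : x ∈ S <;> simp [hf, hx]
  obtain ⟨hq, hqq⟩ := h.abs_law_deviation_le ht x₀ hw0 hw1 hw0' hw1' hδ h1 h2 hf1
  have hs_lower : ∀ v : Edge n → ℝ, (∀ e, 0 ≤ v e) → (∀ e, v e ≤ 1) →
      κ ≤ mean (gibbs β v) f := by
    intro v hv0 hv1
    have hg := gibbs_reversible x₀ β v
    calc κ ≤ gibbs β v y * f y := by
          rw [hf, Set.indicator_of_mem hy, Pi.one_apply, mul_one]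
          exact le_gibbs x₀ hβ0 hv0 hv1 ht (h.exp_invTemp_le ht) y
      _ ≤ _ := Finset.single_le_sum (f := fun x => gibbs β v x * f x)
          (fun x _ => mul_nonneg (hg.weight_nonneg x) (hf0 x)) (Finset.mem_univ y)
  set E := Real.exp (-(β * δ)) with hE
  -- This linear lower bound in `δ` is where `β ≤ 1` enters.
  have hE1 : β * δ / 2 ≤ 1 - E := by
    have e1 : 1 + β * δ ≤ Real.exp (β * δ) := by linarith [Real.add_one_le_exp (β * δ)]
    have e2 : E * Real.exp (β * δ) = 1 := by rw [hE, ← Real.exp_add]; simp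
    have e3 : 0 < E := Real.exp_pos _
    have e4 : β * δ ≤ 1 := mul_le_one₀ hβ1 hδ hδ1
    have e5 : 0 ≤ β * δ := mul_nonneg hβ0 hδ
    have e6 : E * (1 + β * δ) ≤ 1 :=
      (mul_le_mul_of_nonneg_left e1 e3.le).trans e2.le
    nlinarith
  have hE2 : 1 - E ≤ β * δ := by linarith [Real.add_one_le_exp (-(β * δ))]
  -- The exact slack in the Gibbs case: the Boltzmann mass of `S` shrinks by the factor `E`, while
  -- the partition function drops by `(1 - E)` times the old mass of `S`.
  have hstat : mean (gibbs β w') f - E * mean (gibbs β w) f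
      = mean (gibbs β w) f * mean (gibbs β w') f * (1 - E) := by
    set A := ∑ x, Real.exp (-β * tourLength w x) * f x with hA
    have eA : ∀ v : Edge n → ℝ, mean (gibbs β v) f
        = (∑ x, Real.exp (-β * tourLength v x) * f x) / partition β v := by
      intro v
      rw [mean, Finset.sum_div]
      refine Finset.sum_congr rfl fun x _ => ?_
      rw [gibbs, div_mul_eq_mul_div]
    have eA' : ∑ x, Real.exp (-β * tourLength w' x) * f x = E * A := by
      rw [hA, Finset.mul_sum]
      refine Finset.sum_congr rfl fun x _ => ?_
      by_cases hx : x ∈ S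
      · rw [hin x hx, hE, ← mul_assoc, ← Real.exp_add]
        congr 2
        ring
      · simp [hf, hx]
    have eZ : partition β w' = partition β w - (1 - E) * A := by
      have : partition β w' = ∑ x, (Real.exp (-β * tourLength w x) * (1 - f x)
          + Real.exp (-β * tourLength w' x) * f x) := by
        refine Finset.sum_congr rfl fun x _ => ?_
        by_cases hx : x ∈ S
        · simp [hf, hx]
        · simp [hf, hx, hout x hx]
      rw [this, Finset.sum_add_distrib, eA']
      simp only [mul_sub, mul_one, Finset.sum_sub_distrib]
      rw [← hA, partition]
      ring
    have hZ := (partition_pos x₀ β w).ne'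
    have hZ' := (partition_pos x₀ β w').ne'
    rw [eA, eA, eA', ← hA]
    field_simp
    rw [eZ]
    ring
  have hprod : κ ^ 2 * (β * δ / 2)
      ≤ mean (gibbs β w) f * mean (gibbs β w') f * (1 - E) := by
    have b1 := hs_lower w hw0 hw1
    have b2 := hs_lower w' hw0' hw1'
    rw [sq]
    refine mul_le_mul (mul_le_mul b1 b2 hκ0.le (hκ0.le.trans b1)) hE1 ?_ ?_
    · exact div_nonneg (mul_nonneg hβ0 hδ) two_pos.le
    · exact mul_nonneg (hκ0.le.trans b1) (hκ0.le.trans b2)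
  have hfin : ξ * (8 * t + 2) * (β * δ / 2) ≤ κ ^ 2 * (β * δ / 2) :=
    mul_le_mul_of_nonneg_right hξ (div_nonneg (mul_nonneg hβ0 hδ) two_pos.le)
  set q := mean (law a L x₀ w t) f - mean (gibbs β w) f with hq_def
  set q' := mean (law a L x₀ w' t) f - mean (gibbs β w') f with hq_def'
  have hqE : -(ξ * (β * δ)) ≤ q * (1 - E) := by
    have c1 : 0 ≤ 1 - E := le_trans (div_nonneg (mul_nonneg hβ0 hδ) two_pos.le) hE1
    have c2 : -ξ ≤ q := (abs_le.1 hq).1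
    nlinarith [h.pos]
  have hd := (abs_le.1 hqq).1
  have e : mean (law a L x₀ w' t) f - E * mean (law a L x₀ w t) f
      = (mean (gibbs β w') f - E * mean (gibbs β w) f) + (q' - q) + q * (1 - E) := by
    rw [hq_def, hq_def']; ring
  rw [hstat] at e
  -- The errors `4 * t * β * δ * ξ` and `ξ * β * δ` add up to `ξ * (8 * t + 2) * (β * δ / 2)`, which
  -- the slack covers.
  nlinarith

end LongEpochs

end Law

/-! ### Averaging over the weights -/

section Averaging

variable {n : ℕ}

/-- The mean of the exponential distribution with parameter `β`, conditioned on `[0, 1]`. -/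
noncomputable def truncMean (β : ℝ) : ℝ := 1 / β - 1 / (Real.exp β - 1)

lemma truncMean_mem {β : ℝ} (hβ : 0 < β) : truncMean β ∈ Set.Icc (0 : ℝ) 1 := by
  have h1 : β ≤ Real.exp β - 1 := by linarith [Real.add_one_le_exp β]
  have h2 : 0 < Real.exp β - 1 := hβ.trans_le h1
  constructor
  · exact sub_nonneg.2 (one_div_le_one_div_of_le hβ h1)
  · have h3 : Real.exp (-β) * Real.exp β = 1 := by rw [← Real.exp_add]; simp
    have h4 : Real.exp β - 1 ≤ β * Real.exp β := by
      have := Real.add_one_le_exp (-β)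
      nlinarith [Real.exp_pos β]
    rw [truncMean, sub_le_iff_le_add, div_le_iff₀ hβ]
    have : (1 + 1 / (Real.exp β - 1)) * β = β * Real.exp β / (Real.exp β - 1) := by
      field_simp
      ring
    rw [this, le_div_iff₀ h2]
    linarith

lemma integral_sub_truncMean_mul_exp {β : ℝ} (hβ : 0 < β) :
    ∫ u in (0 : ℝ)..1, (u - truncMean β) * Real.exp (-(β * u)) = 0 := by
  set m := truncMean β with hm
  have hderiv : ∀ u ∈ Set.uIcc (0 : ℝ) 1, HasDerivAt
      (fun u => -Real.exp (-(β * u)) * ((u - m) / β + 1 / β ^ 2))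
      ((u - m) * Real.exp (-(β * u))) u := by
    intro u _
    have d1 : HasDerivAt (fun u => -(β * u)) (-(β * 1)) u := ((hasDerivAt_id u).const_mul β).neg
    have d2 : HasDerivAt (fun u => (u - m) / β + 1 / β ^ 2) (1 / β) u :=
      (((hasDerivAt_id u).sub_const m).div_const β).add_const _
    refine (d1.exp.neg.mul d2).congr_deriv ?_
    simp only [Pi.neg_apply]
    field_simp
    ring
  rw [intervalIntegral.integral_eq_sub_of_hasDerivAt hderiv
    (Continuous.intervalIntegrable (by fun_prop) _ _)]
  have h1 : 0 < Real.exp β - 1 := by linarith [Real.add_one_lt_exp hβ.ne']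
  rw [mul_one, mul_zero, neg_zero, Real.exp_zero, Real.exp_neg, hm, truncMean]
  have := (Real.exp_pos β).ne'
  field_simp
  ring

/-- Chebyshev's association inequality for a density proportional to `exp (-β u)`. -/
lemma integral_sub_truncMean_mul_nonneg {β : ℝ} (hβ : 0 < β) {p : ℝ → ℝ} (hp : Continuous p)
    (hmono : ∀ u v, 0 ≤ u → u ≤ v → v ≤ 1 → Real.exp (-(β * (v - u))) * p u ≤ p v) :
    0 ≤ ∫ u in Set.Icc (0 : ℝ) 1, (u - truncMean β) * p u := by
  obtain ⟨hm0, hm1⟩ := truncMean_mem hβ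
  set m := truncMean β with hm
  have hzero : ∫ u in Set.Icc (0 : ℝ) 1, Real.exp (β * m) * p m * ((u - m) * Real.exp (-(β * u)))
      = 0 := by
    rw [integral_const_mul, integral_Icc_eq_integral_Ioc,
      ← intervalIntegral.integral_of_le (zero_le_one' ℝ), integral_sub_truncMean_mul_exp hβ, mul_zero]
  refine hzero.ge.trans (setIntegral_mono_on ?_ ?_ measurableSet_Icc fun u hu => ?_)
  · exact (show Continuous fun u : ℝ => Real.exp (β * m) * p m * ((u - m) * Real.exp (-(β * u)))
      by fun_prop).integrableOn_Icc
  · exact (show Continuous fun u : ℝ => (u - m) * p u by fun_prop).integrableOn_Icc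
  · have e : Real.exp (β * m) * p m * ((u - m) * Real.exp (-(β * u)))
        = (u - m) * (Real.exp (β * m + -(β * u)) * p m) := by rw [Real.exp_add]; ring
    rw [e]
    rcases le_total u m with h | h
    · have h1 := hmono u m hu.1 h hm1
      have h2 : p u ≤ Real.exp (β * m + -(β * u)) * p m := by
        have h3 : Real.exp (β * m + -(β * u)) * Real.exp (-(β * (m - u))) = 1 := by
          rw [← Real.exp_add, ← Real.exp_zero]; congr 1; ring
        calc p u = Real.exp (β * m + -(β * u)) * (Real.exp (-(β * (m - u))) * p u) := by
              rw [← mul_assoc, h3, one_mul]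
          _ ≤ _ := mul_le_mul_of_nonneg_left h1 (Real.exp_pos _).le
      exact mul_le_mul_of_nonpos_left h2 (by linarith)
    · have h1 := hmono m u hm0 h hu.2
      rw [show -(β * (u - m)) = β * m + -(β * u) by ring] at h1
      exact mul_le_mul_of_nonneg_left h1 (by linarith)

/-- The uniform distribution on `[0, 1]`. -/
noncomputable abbrev unif : Measure ℝ := volume.restrict (Set.Icc (0 : ℝ) 1)

instance : IsProbabilityMeasure unif := ⟨by simp [unif]⟩

instance : IsProbabilityMeasure (weightMeasure n) := by
  unfold weightMeasure
  infer_instance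

lemma ae_weight_mem (n : ℕ) : ∀ᵐ w ∂(weightMeasure n), ∀ e, w e ∈ Set.Icc (0 : ℝ) 1 := by
  rw [ae_all_iff]
  intro e
  have h := measurePreserving_eval (fun _ : Edge n => unif) e
  exact h.quasiMeasurePreserving.ae (ae_restrict_mem measurableSet_Icc)

/-- Resampling one weight does not change the distribution. -/
lemma measurePreserving_update [DecidableEq (Edge n)] (e : Edge n) :
    MeasurePreserving (fun z : (Edge n → ℝ) × ℝ => Function.update z.1 e z.2)
      ((weightMeasure n).prod unif) (weightMeasure n) := by
  have hmeas : Measurable fun z : (Edge n → ℝ) × ℝ => Function.update z.1 e z.2 := by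
    refine measurable_pi_lambda _ fun i => ?_
    by_cases hi : i = e
    · subst hi
      simpa using measurable_snd
    · simpa [Function.update_of_ne hi] using
        (show Measurable fun z : (Edge n → ℝ) × ℝ => z.1 i by fun_prop)
  refine ⟨hmeas, ?_⟩
  symm
  refine Measure.pi_eq fun s hs => ?_
  rw [Measure.map_apply hmeas (MeasurableSet.univ_pi hs)]
  have hpre : (fun z : (Edge n → ℝ) × ℝ => Function.update z.1 e z.2) ⁻¹' Set.univ.pi s
      = (Set.univ.pi (Function.update s e Set.univ)) ×ˢ s e := by
    ext z
    simp only [Set.mem_preimage, Set.mem_univ_pi, Set.mem_prod]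
    constructor
    · intro h
      refine ⟨fun i => ?_, by simpa using h e⟩
      by_cases hi : i = e
      · subst hi; simp
      · simpa [Function.update_of_ne hi] using h i
    · rintro ⟨h1, h2⟩ i
      by_cases hi : i = e
      · subst hi; simpa using h2
      · simpa [Function.update_of_ne hi] using h1 i
  rw [hpre, Measure.prod_prod, weightMeasure, Measure.pi_pi,
    ← Finset.mul_prod_erase _ _ (Finset.mem_univ e),
    ← Finset.mul_prod_erase _ (fun i => unif (s i)) (Finset.mem_univ e)]
  rw [Function.update_self, show (volume.restrict (Set.Icc (0 : ℝ) 1)) Set.univ = 1 from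
    measure_univ (μ := unif), one_mul, mul_comm]
  congr 1
  refine Finset.prod_congr rfl fun i hi => ?_
  rw [Function.update_of_ne (Finset.ne_of_mem_erase hi)]

lemma continuous_tourLength (x : Tour n) : Continuous fun w : Edge n → ℝ => tourLength w x := by
  unfold tourLength
  fun_prop

lemma continuous_transition (β : ℝ) :
    Continuous fun w : Edge n → ℝ => transition β w := by
  have hmove : ∀ x y : Tour n, Continuous fun w : Edge n → ℝ => moveProb β w x y := by
    intro x y
    have h1 := continuous_tourLength x
    have h2 := continuous_tourLength y
    unfold moveProb
    fun_prop
  refine continuous_matrix fun x y => ?_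
  simp only [transition, Matrix.of_apply]
  split_ifs
  · exact hmove x y
  · exact continuous_const.sub (continuous_finsetSum _ fun z _ => hmove x z)
  · exact continuous_const

lemma continuous_law (a : ℝ) (L : ℕ → ℕ) (x₀ : Tour n) (k : ℕ) :
    Continuous fun w : Edge n → ℝ => law a L x₀ w k := by
  induction k with
  | zero => exact continuous_const
  | succ k ih => exact ih.matrix_vecMul ((continuous_transition _).pow _)

lemma continuous_mean_law (a : ℝ) (L : ℕ → ℕ) (x₀ : Tour n) (k : ℕ) (f : Tour n → ℝ) :
    Continuous fun w : Edge n → ℝ => mean (law a L x₀ w k) f := by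
  unfold mean
  exact continuous_finsetSum _ fun x _ =>
    ((continuous_apply x).comp (continuous_law a L x₀ k)).mul continuous_const

lemma tourLength_update [DecidableEq (Edge n)] (w : Edge n → ℝ) (e : Edge n) (u v : ℝ)
    (x : Tour n) : tourLength (Function.update w e v) x
      = tourLength (Function.update w e u) x + if e ∈ x.1 then v - u else 0 := by
  unfold tourLength
  rw [← sub_eq_iff_eq_add', ← Finset.sum_sub_distrib, ← Finset.sum_ite_eq' x.1 e fun _ => v - u]
  refine Finset.sum_congr rfl fun i _ => ?_
  by_cases hi : i = e
  · subst hi; simp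
  · simp [hi]

namespace LongEpochs

variable {a ξ : ℝ} {L : ℕ → ℕ} {t : ℕ}

lemma integral_weight_sub_mul_nonneg (h : LongEpochs n a L t ξ) (ht : 1 ≤ t) (x₀ : Tour n)
    (hξ : ξ * (8 * t + 2) ≤ (1 / ((t : ℝ) * n ^ n)) ^ 2) (hβ0 : 0 < invTemp a t)
    (hβ1 : invTemp a t ≤ 1) (e : Edge n)
    (hint : Integrable (fun w => (w e - truncMean (invTemp a t))
      * mean (law a L x₀ w t) ({x | e ∈ x.1}.indicator 1)) (weightMeasure n)) :
    0 ≤ ∫ w, (w e - truncMean (invTemp a t))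
      * mean (law a L x₀ w t) ({x | e ∈ x.1}.indicator 1) ∂(weightMeasure n) := by
  classical
  have hmp := measurePreserving_update e
  set G : (Edge n → ℝ) → ℝ := fun w => (w e - truncMean (invTemp a t))
      * mean (law a L x₀ w t) ({x | e ∈ x.1}.indicator 1) with hG
  have hcomp : Integrable (fun z : (Edge n → ℝ) × ℝ => G (Function.update z.1 e z.2))
      ((weightMeasure n).prod unif) := hmp.integrable_comp_of_integrable hint
  have e1 : ∫ w, G w ∂(weightMeasure n)
      = ∫ z, G (Function.update z.1 e z.2) ∂((weightMeasure n).prod unif) := by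
    have hae : AEStronglyMeasurable G (Measure.map
      (fun z : (Edge n → ℝ) × ℝ => Function.update z.1 e z.2) ((weightMeasure n).prod unif)) := by
      rw [hmp.map_eq]; exact hint.aestronglyMeasurable
    rw [← integral_map hmp.measurable.aemeasurable hae, hmp.map_eq]
  -- By Fubini the weight of `e` is integrated first, with the other weights frozen.
  rw [e1, integral_prod _ hcomp]
  refine integral_nonneg_of_ae ?_
  filter_upwards [ae_weight_mem n] with w hw
  have hcont : Continuous fun u : ℝ =>
      mean (law a L x₀ (Function.update w e u) t) ({x | e ∈ x.1}.indicator 1) :=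
    (continuous_mean_law a L x₀ t _).comp (continuous_const.update e continuous_id)
  have := integral_sub_truncMean_mul_nonneg hβ0 hcont fun u v hu huv hv => by
    have hbox : ∀ r, 0 ≤ r → r ≤ 1 → ∀ i, Function.update w e r i ∈ Set.Icc (0 : ℝ) 1 := by
      intro r hr0 hr1 i
      by_cases hi : i = e
      · subst hi; simp [hr0, hr1]
      · rw [Function.update_of_ne hi]; exact hw i
    have hbu := hbox u hu (huv.trans hv)
    have hbv := hbox v (hu.trans huv) hv
    exact h.exp_mul_mean_law_le ht x₀ hξ hβ1 (fun i => (hbu i).1) (fun i => (hbu i).2)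
      (fun i => (hbv i).1) (fun i => (hbv i).2) (sub_nonneg.2 huv) (by linarith) {x | e ∈ x.1}
      (fun x hx => by rw [tourLength_update w e u v, if_pos (show e ∈ x.1 from hx)])
      (fun x hx => by rw [tourLength_update w e u v, if_neg (show e ∉ x.1 from hx), add_zero])
  simpa [hG] using this

/-- The lower bound for the expected length, given quantitative bounds on the epochs. -/
lemma le_expectedLength (h : LongEpochs n a L t ξ) (ht : 1 ≤ t) (x₀ : Tour n)
    (hξ : ξ * (8 * t + 2) ≤ (1 / ((t : ℝ) * n ^ n)) ^ 2) (hβ0 : 0 < invTemp a t)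
    (hβ1 : invTemp a t ≤ 1) :
    n * truncMean (invTemp a t) ≤ expectedLength a L x₀ t := by
  classical
  set m := truncMean (invTemp a t) with hm
  set p : Edge n → (Edge n → ℝ) → ℝ := fun e w =>
    mean (law a L x₀ w t) ({x | e ∈ x.1}.indicator 1) with hp
  have hpcont : ∀ e, Continuous (p e) := fun e => continuous_mean_law a L x₀ t _
  have hint : ∀ e, Integrable (fun w => (w e - m) * p e w) (weightMeasure n) := by
    intro e
    have hc := hpcont e
    refine Integrable.of_bound (C := 1 + |m|)
      (Continuous.aestronglyMeasurable (by fun_prop)) ?_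
    filter_upwards [ae_weight_mem n] with w hw
    have h1 : |p e w| ≤ 1 := abs_mean_le (law_isProb a L x₀ w t).1 (law_isProb a L x₀ w t).2
      fun x => by by_cases hx : e ∈ x.1 <;> simp [hx]
    have h2 : |w e - m| ≤ 1 + |m| := (abs_sub _ _).trans (by
      gcongr
      rw [abs_of_nonneg (hw e).1]
      exact (hw e).2)
    rw [Real.norm_eq_abs, abs_mul]
    calc |w e - m| * |p e w| ≤ (1 + |m|) * 1 :=
          mul_le_mul h2 h1 (abs_nonneg _) (by positivity)
      _ = _ := mul_one _
  -- Every tour has exactly `n` edges, so subtracting `m` from each weight shifts every length by `n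
  -- * m`.
  have hsum : ∀ w : Edge n → ℝ, ∑ x, law a L x₀ w t x * tourLength w x
      = n * m + ∑ e, (w e - m) * p e w := by
    intro w
    have e1 : ∑ e, (w e - m) * p e w
        = ∑ x, law a L x₀ w t x * ∑ e ∈ x.1, (w e - m) := by
      simp only [hp, mean, Finset.mul_sum]
      rw [Finset.sum_comm]
      refine Finset.sum_congr rfl fun x _ => ?_
      rw [← Finset.sum_subset (Finset.subset_univ x.1)]
      · refine Finset.sum_congr rfl fun e he => ?_
        rw [Set.indicator_of_mem (show x ∈ {x : Tour n | e ∈ x.1} from he), Pi.one_apply]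
        ring
      · intro e _ he
        rw [Set.indicator_of_notMem (show x ∉ {x : Tour n | e ∈ x.1} from he)]
        ring
    have e2 : ∀ x : Tour n, ∑ e ∈ x.1, (w e - m) = tourLength w x - n * m := by
      intro x
      rw [Finset.sum_sub_distrib, Finset.sum_const, card_tour, nsmul_eq_mul, tourLength]
    rw [e1]
    simp only [e2, mul_sub, Finset.sum_sub_distrib]
    rw [← Finset.sum_mul, (law_isProb a L x₀ w t).2]
    ring
  have hE : expectedLength a L x₀ t
      = n * m + ∑ e, ∫ w, (w e - m) * p e w ∂(weightMeasure n) := by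
    rw [expectedLength]
    simp only [hsum]
    rw [integral_add (integrable_const _) (integrable_finsetSum _ fun e _ => hint e),
      integral_finsetSum _ fun e _ => hint e]
    simp
  rw [hE, le_add_iff_nonneg_right]
  exact Finset.sum_nonneg fun e _ =>
    h.integral_weight_sub_mul_nonneg ht x₀ hξ hβ0 hβ1 e (hint e)

end LongEpochs

end Averaging

/-! ### Epochs of the prescribed length are long enough -/

section Asymptotics

/-- The mixing error of an epoch is superexponentially small. -/
lemma mul_rate_pow_le {n k l : ℕ} (hn : 15 ≤ n) (hk : 1 ≤ k) (hkn : (k : ℝ) ≤ (n : ℝ) ^ n)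
    {c : ℝ} (hc : 24 * (18 * 1024 ^ 2) ≤ c * (n : ℝ) ^ 2)
    (hl : c * ((n : ℝ) ^ 9 * (k : ℝ) ^ 2 * Real.log n) ≤ l) :
    ((l : ℝ) + 1) * rate n k ^ (l - 1) ≤ 1 / ((n : ℝ) ^ n) ^ 8 := by
  have hn15 : (15 : ℝ) ≤ n := by exact_mod_cast hn
  have hn0 : (0 : ℝ) < n := by linarith
  have hk0 : (0 : ℝ) < k := by exact_mod_cast hk
  have hk1 : (1 : ℝ) ≤ k := by exact_mod_cast hk
  set N : ℝ := (n : ℝ) ^ n with hN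
  have hN0 : 0 < N := by positivity
  have hlog : 0 < Real.log n := Real.log_pos (by linarith)
  set D : ℝ := 18 * 1024 ^ 2 * n ^ 6 * k ^ 2 with hD
  have hD0 : 0 < D := by positivity
  have hD1 : 1 ≤ D := by
    have h1 : (1 : ℝ) ≤ n ^ 6 := one_le_pow₀ (by linarith)
    have h2 : (1 : ℝ) ≤ k ^ 2 := one_le_pow₀ hk1
    exact one_le_mul_of_one_le_of_one_le
      (one_le_mul_of_one_le_of_one_le (by norm_num) h1) h2
  have hrate : rate n k = 1 - 1 / D := by
    rw [rate, hD]; congr 2; ring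
  set y : ℝ := l / D with hy
  -- The relaxation time `D` is of order `n ^ 6 * k ^ 2`. Of the nine powers of `n` in the epoch
  -- length, one supplies `n * log n` and two absorb the constant `c`.
  have hy12 : 24 * (n * Real.log n) ≤ y := by
    rw [hy, le_div_iff₀ hD0]
    refine le_trans ?_ hl
    calc 24 * (n * Real.log n) * D
        = 24 * (18 * 1024 ^ 2) * (n ^ 7 * k ^ 2 * Real.log n) := by rw [hD]; ring
      _ ≤ c * n ^ 2 * (n ^ 7 * k ^ 2 * Real.log n) := by gcongr
      _ = _ := by ring
  have hy0 : 0 < y := lt_of_lt_of_le (by positivity) hy12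
  have hl0 : 0 < (l : ℝ) := by
    have : (l : ℝ) = y * D := by rw [hy]; field_simp
    rw [this]; positivity
  have hl1 : 1 ≤ l := by exact_mod_cast hl0
  have hl1' : (1 : ℝ) ≤ l := by exact_mod_cast hl1
  have hρ : 0 ≤ rate n k := rate_nonneg (by omega) hk
  -- The factor `3` bounds `exp (1 / D)`, the price of the exponent `l - 1` in place of `l`.
  have hpow : rate n k ^ (l - 1) ≤ 3 * Real.exp (-y) := by
    calc rate n k ^ (l - 1) ≤ Real.exp (-(1 / D)) ^ (l - 1) :=
          pow_le_pow_left₀ hρ (by rw [hrate]; linarith [Real.add_one_le_exp (-(1 / D))]) _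
      _ = Real.exp (1 / D) * Real.exp (-y) := by
          rw [← Real.exp_nat_mul, ← Real.exp_add, Nat.cast_sub hl1, hy]
          congr 1
          push_cast
          field_simp
          ring
      _ ≤ 3 * Real.exp (-y) := by
          refine mul_le_mul_of_nonneg_right ?_ (Real.exp_pos _).le
          have h1 : Real.exp (1 / D) ≤ Real.exp 1 :=
            Real.exp_le_exp.2 ((div_le_one hD0).2 hD1)
          linarith [Real.exp_one_lt_d9]
  -- Half of the decay `exp (-y)` pays for the prefactor `l + 1`; the other half gives `1 / N ^ 12`.
  have hlD : (l : ℝ) + 1 ≤ 4 * D * Real.exp (y / 2) := by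
    have h1 : (l : ℝ) = y * D := by rw [hy]; field_simp
    have h2 : y / 2 ≤ Real.exp (y / 2) := by linarith [Real.add_one_le_exp (y / 2)]
    calc (l : ℝ) + 1 ≤ 2 * l := by linarith
      _ = 4 * D * (y / 2) := by rw [h1]; ring
      _ ≤ _ := by gcongr
  have hexp : Real.exp (-(y / 2)) ≤ 1 / N ^ 12 := by
    have h1 : N = Real.exp (n * Real.log n) := by
      rw [Real.exp_nat_mul, Real.exp_log hn0]
    rw [h1, ← Real.exp_nat_mul, one_div, ← Real.exp_neg]
    refine Real.exp_le_exp.2 ?_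
    push_cast
    linarith
  have hNn : 12 * (18 * 1024 ^ 2 * (n : ℝ) ^ 6) ≤ N := by
    calc 12 * (18 * 1024 ^ 2 * (n : ℝ) ^ 6) ≤ 15 ^ 9 * (n : ℝ) ^ 6 := by
          rw [← mul_assoc]
          exact mul_le_mul_of_nonneg_right (by norm_num) (by positivity)
      _ ≤ n ^ 9 * (n : ℝ) ^ 6 := by gcongr
      _ = (n : ℝ) ^ 15 := by ring
      _ ≤ N := pow_le_pow_right₀ (by linarith) hn
  have hN1 : 1 ≤ N := one_le_pow₀ (by linarith)
  calc ((l : ℝ) + 1) * rate n k ^ (l - 1)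
      ≤ 4 * D * Real.exp (y / 2) * (3 * Real.exp (-y)) := by gcongr
    _ = 12 * D * Real.exp (-(y / 2)) := by
        have : Real.exp (y / 2) * Real.exp (-y) = Real.exp (-(y / 2)) := by
          rw [← Real.exp_add]; congr 1; ring
        rw [← this]; ring
    _ ≤ 12 * D * (1 / N ^ 12) := by gcongr
    _ = 12 * (18 * 1024 ^ 2 * (n : ℝ) ^ 6) * k ^ 2 * (1 / N ^ 12) := by rw [hD]; ring
    _ ≤ N * N ^ 2 * (1 / N ^ 12) := by gcongr
    _ = 1 / N ^ 9 := by field_simp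
    _ ≤ 1 / N ^ 8 := one_div_le_one_div_of_le (by positivity)
        (pow_le_pow_right₀ hN1 (by norm_num))

/-- Epochs of the prescribed length satisfy the quantitative mixing bounds. -/
lemma exists_longEpochs {n t : ℕ} {a c : ℝ} {L : ℕ → ℕ} (hn : 15 ≤ n) (ha : (n : ℝ) ≤ a)
    (ht1 : 1 ≤ t) (htn : (t : ℝ) ≤ (n : ℝ) ^ n) (hc : 24 * (18 * 1024 ^ 2) ≤ c * (n : ℝ) ^ 2)
    (hL : ∀ k ∈ Finset.Icc 1 t, c * ((n : ℝ) ^ 9 * (k : ℝ) ^ 2 * Real.log n) ≤ L k) :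
    ∃ ξ, LongEpochs n a L t ξ ∧ ξ * (8 * t + 2) ≤ (1 / ((t : ℝ) * n ^ n)) ^ 2 := by
  have hn15 : (15 : ℝ) ≤ n := by exact_mod_cast hn
  have ht0 : (1 : ℝ) ≤ t := by exact_mod_cast ht1
  set N : ℝ := (n : ℝ) ^ n with hN
  have hN15 : 15 ≤ N := hn15.trans (le_self_pow₀ (by linarith) (by omega))
  have hN0 : 0 < N := by linarith
  -- Since `t ≥ 1`, `10 * t` dominates `8 * t + 2`.
  refine ⟨1 / (10 * t * (t * N) ^ 2), ⟨hn, ha, by positivity, ?_, fun k hk => ?_⟩, ?_⟩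
  · rw [div_le_one (by positivity)]
    have h1 : 1 ≤ (t * N) ^ 2 := one_le_pow₀ (one_le_mul_of_one_le_of_one_le ht0 (by linarith))
    exact one_le_mul_of_one_le_of_one_le (by linarith) h1
  · obtain ⟨hk1, hkt⟩ := Finset.mem_Icc.1 hk
    have hkt' : (k : ℝ) ≤ t := by exact_mod_cast hkt
    have hmix := mul_rate_pow_le hn hk1 (hkt'.trans htn) hc (hL k hk)
    rw [div_div_eq_mul_div, div_one, ← hN]
    calc ((L k : ℝ) + 1) * rate n k ^ (L k - 1) * (k * N) ≤ 1 / N ^ 8 * (N * N) := by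
          rw [← hN] at hmix
          gcongr
          exact hkt'.trans htn
      _ = 1 / (N * N * (N * N) ^ 2) := by field_simp
      _ ≤ 1 / (10 * t * (t * N) ^ 2) := by
          gcongr
          linarith
  · rw [div_mul_eq_mul_div, one_mul, div_pow, one_pow, div_le_div_iff₀ (by positivity)
      (by positivity), one_mul]
    exact mul_le_mul_of_nonneg_right (by linarith) (by positivity)

end Asymptotics

end SimAnn

theorem mainTheorem3
    (t : ℕ → ℕ) (a : ℕ → ℝ) (L : ℕ → ℕ → ℕ)
    (ht_two : ∀ᶠ n in atTop, 2 ≤ t n)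
    (ht : (fun n : ℕ => Real.logb 2 (t n)) =o[atTop] fun n : ℕ => (n : ℝ))
    (ha : ∀ᶠ n : ℕ in atTop, (n : ℝ) ≤ a n)
    (hL : ∃ c : ℝ, 0 < c ∧ ∀ᶠ n : ℕ in atTop, ∀ k ∈ Finset.Icc 1 (t n),
      c * ((n : ℝ) ^ 9 * (k : ℝ) ^ 2 * Real.log n) ≤ L n k) :
    ∀ᶠ n : ℕ in atTop, ∀ x₀ : SimAnn.Tour n,
      (n : ℝ) * (a n / Real.log (t n) - 1 / ((t n : ℝ) ^ (1 / a n) - 1))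
        ≤ SimAnn.expectedLength (a n) (L n) x₀ (t n) := by
  obtain ⟨c, hc, hL⟩ := hL
  have hlarge : ∀ᶠ n : ℕ in atTop, 24 * (18 * 1024 ^ 2) ≤ c * (n : ℝ) ^ 2 :=
    (((tendsto_pow_atTop two_ne_zero).comp tendsto_natCast_atTop_atTop).const_mul_atTop
      hc).eventually_ge_atTop _
  filter_upwards [ht_two, ht.def one_pos, ha, hL, hlarge, eventually_ge_atTop 15]
    with n ht2 htn han hLn hcn hn x₀
  have ht2' : (2 : ℝ) ≤ t n := by exact_mod_cast ht2
  have ht0 : (0 : ℝ) < t n := by linarith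
  have hn15 : (15 : ℝ) ≤ n := by exact_mod_cast hn
  have ha0 : 0 < a n := by linarith
  have hlogb : Real.logb 2 (t n) ≤ n := by
    rw [one_mul, Real.norm_eq_abs, Real.norm_eq_abs, Nat.abs_cast] at htn
    exact (le_abs_self _).trans htn
  -- Subexponential growth of `t` is used only through this bound, which yields `t ≤ n ^ n` and `β ≤
  -- 1`.
  have htpow : (t n : ℝ) ≤ 2 ^ n := by
    rw [Real.logb_le_iff_le_rpow one_lt_two ht0, Real.rpow_natCast] at hlogb
    exact hlogb
  have htN : (t n : ℝ) ≤ (n : ℝ) ^ n :=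
    htpow.trans (pow_le_pow_left₀ zero_le_two (by linarith) n)
  have hlog0 : 0 < Real.log (t n) := Real.log_pos (by linarith)
  have hlogn : Real.log (t n) ≤ n := by
    have h1 : Real.log (t n) ≤ Real.log (Real.exp n) := by
      refine Real.log_le_log ht0 (htpow.trans ?_)
      rw [← mul_one (n : ℝ), Real.exp_nat_mul]
      exact pow_le_pow_left₀ zero_le_two (by linarith [Real.add_one_le_exp (1 : ℝ)]) n
    rwa [Real.log_exp] at h1
  obtain ⟨ξ, hlong, hξ⟩ := SimAnn.exists_longEpochs hn han (by omega : 1 ≤ t n) htN hcn hLn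
  have key := hlong.le_expectedLength (by omega) x₀ hξ (div_pos hlog0 ha0)
    ((div_le_one ha0).2 (hlogn.trans han))
  have hmean : SimAnn.truncMean (SimAnn.invTemp (a n) (t n))
      = a n / Real.log (t n) - 1 / ((t n : ℝ) ^ (1 / a n) - 1) := by
    rw [SimAnn.truncMean, SimAnn.invTemp, one_div_div, Real.rpow_def_of_pos ht0, mul_one_div]
  rwa [hmean] at key
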